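/- Let $A$ be a ring with identity, and for a ring $R$ let $\mathrm{mod}\text{-}R$ be the category of finitely presented right $R$-modules, so that $\mathrm{mod}\text{-}A^{op}$ is the category of finitely presented left $A$-modules. Let $\mathrm{mod}\text{-}(\mathrm{mod}\text{-}R)$ be the category of finitely presented functors $F:\mathrm{mod}\text{-}R\to\mathrm{Ab}$, i.e. those admitting a sequence $\mathrm{Hom}_R(Y,-)\to\mathrm{Hom}_R(X,-)\to F\to 0$ with $X,Y\in\mathrm{mod}\text{-}R$ that is exact at every object. Let $\mathbb{R}$ be the additive category with objects $R^n$ $(n\ge 0)$ and $\mathrm{Hom}(R^n,R^m)=\mathrm{Mat}_{m\times n}(R)$, matrices acting from the left on column vectors. Let $\mathrm{III}(\mathbb{R})$ be Adelman's category: its objects are chains $R^m\xrightarrow{u}R^n\xrightarrow{v}R^p$ (with no condition on $vu$), its morphisms are commutative diagrams $(\alpha_1,\alpha_2,\alpha_3)$ from $(u,v)$ to $(u',v')$ modulo those with $\alpha_2=u's+tv$ for some matrices $s,t$. Let $$\mathfrak{k}_R:\big(\mathrm{mod}\text{-}(\mathrm{mod}\text{-}R)\big)^{op}\to\mathrm{III}(\mathbb{R})$$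 be the equivalence whose quasi-inverse $\mathfrak{k}_R^{-1}$ sends a chain $(u,v)$ to the cokernel of the natural transformation $\mathrm{Hom}_R(\mathrm{Coker}(vu),-)\to\mathrm{Hom}_R(\mathrm{Coker}\,u,-)$ given by composition with the homomorphism $\mathrm{Coker}\,u\to\mathrm{Coker}(vu)$ induced by $v$, and sends a morphism of chains to the induced morphism of cokernels. Let $d:\mathrm{mod}\text{-}(\mathrm{mod}\text{-}A)\to\mathrm{mod}\text{-}(\mathrm{mod}\text{-}A^{op})$ be the (contravariant) Auslander–Gruson–Jensen duality: if $F$ has a projective presentation $\mathrm{Hom}_A(Y,-)\xrightarrow{\mathrm{Hom}_A(f,-)}\mathrm{Hom}_A(X,-)\to F\to 0$, then $dF=\mathrm{Ker}\big(X\otimes_A-\xrightarrow{f\otimes_A-}Y\otimes_A-\big)$, and $d$ acts on morphisms by lifting them to the presentations and passing to the induced morphisms of kernels. Let $d_{\mathrm{III}}:\mathrm{III}(\mathbb{A})\to\mathrm{III}(\mathbb{A}^{op})$, where $\mathrm{III}(\mathbb{A}^{op})$ denotes Adelman's category for the ring $A^{op}$, be the contravariant functor that reverses all arrows and replaces left multiplication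 by a matrix on column vectors by right multiplication by the same matrix on row vectors; equivalently, each matrix over $A$ is replaced by its transpose, regarded as a matrix over $A^{op}$. Then there is a natural isomorphism $$d_{\mathrm{III}}\circ\mathfrak{k}_A\;\cong\;\mathfrak{k}_{A^{op}}\circ d .$$ -/

import Mathlib

open CategoryTheory CategoryTheory.Limits Opposite

universe v u

noncomputable section

namespace AGJ

section FinitelyPresentedFunctors

variable {C : Type u} [Category.{v} C]

theorem cokernel_app_surjective {F G : C ⥤ AddCommGrpCat.{v}} (α : F ⟶ G) (M : C) :
    Function.Surjective ((cokernel.π α).app M) :=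
  (AddCommGrpCat.epi_iff_surjective _).1 inferInstance

theorem cokernel_app_exact {F G : C ⥤ AddCommGrpCat.{v}} (α : F ⟶ G) (M : C) :
    Function.Exact (α.app M) ((cokernel.π α).app M) := by
  have h := (ShortComplex.exact_cokernel α).map ((evaluation C AddCommGrpCat.{v}).obj M)
  exact (ShortComplex.ab_exact_iff_function_exact _).1 h

theorem kernel_app_injective {F G : C ⥤ AddCommGrpCat.{v}} (α : F ⟶ G) (M : C) :
    Function.Injective ((kernel.ι α).app M) :=
  (AddCommGrpCat.mono_iff_injective _).1 inferInstance

theorem kernel_app_exact {F G : C ⥤ AddCommGrpCat.{v}} (α : F ⟶ G) (M : C) :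
    Function.Exact ((kernel.ι α).app M) (α.app M) := by
  have h := (ShortComplex.exact_kernel α).map ((evaluation C AddCommGrpCat.{v}).obj M)
  exact (ShortComplex.ab_exact_iff_function_exact _).1 h

variable [Preadditive C]

/-- The covariant representable functor `Hom(X, -)` with values in abelian groups. -/
abbrev homFunctor (X : C) : C ⥤ AddCommGrpCat.{v} := preadditiveCoyoneda.obj (op X)

/-- The natural transformation `Hom(f, -) : Hom(Y, -) ⟶ Hom(X, -)` given by `f : X ⟶ Y`. -/
abbrev homFunctorMap {X Y : C} (f : X ⟶ Y) : homFunctor Y ⟶ homFunctor X :=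
  preadditiveCoyoneda.map f.op

/-- A functor `F` is finitely presented if there is a sequence
`Hom(Y, -) ⟶ Hom(X, -) ⟶ F ⟶ 0` which is exact when evaluated at any object. -/
def IsFinitelyPresentedFunctor : ObjectProperty (C ⥤ AddCommGrpCat.{v}) := fun F =>
  ∃ (X Y : C) (η : homFunctor Y ⟶ homFunctor X) (π : homFunctor X ⟶ F),
    ∀ M : C, Function.Exact (η.app M) (π.app M) ∧ Function.Surjective (π.app M)

/-- The value at `g : X ⟶ M` of a natural transformation `Hom(X, -) ⟶ F`. -/
def ev {X : C} {F : C ⥤ AddCommGrpCat.{v}} (π : homFunctor X ⟶ F) {M : C} (g : X ⟶ M) :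
    F.obj M := (π.app M).hom g

theorem ev_comp {X : C} {F : C ⥤ AddCommGrpCat.{v}} (π : homFunctor X ⟶ F) {M N : C}
    (g : X ⟶ M) (h : M ⟶ N) : ev π (g ≫ h) = F.map h (ev π g) :=
  congr($(π.naturality h) g)

theorem ev_sub {X : C} {F : C ⥤ AddCommGrpCat.{v}} (π : homFunctor X ⟶ F) {M : C}
    (g h : X ⟶ M) : ev π (g - h) = ev π g - ev π h :=
  map_sub (π.app M).hom g h

theorem ev_add {X : C} {F : C ⥤ AddCommGrpCat.{v}} (π : homFunctor X ⟶ F) {M : C}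
    (g h : X ⟶ M) : ev π (g + h) = ev π g + ev π h :=
  map_add (π.app M).hom g h

theorem ev_trans {X : C} {F G : C ⥤ AddCommGrpCat.{v}} (π : homFunctor X ⟶ F) (α : F ⟶ G)
    {M : C} (g : X ⟶ M) : ev (π ≫ α) g = α.app M (ev π g) := rfl

theorem ev_homFunctorMap {X Y : C} {F : C ⥤ AddCommGrpCat.{v}} (f : X ⟶ Y)
    (π : homFunctor X ⟶ F) {M : C} (g : Y ⟶ M) : ev (homFunctorMap f ≫ π) g = ev π (f ≫ g) := rfl

theorem homFunctorMap_comp {X Y Z : C} (f : X ⟶ Y) (g : Y ⟶ Z) :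
    homFunctorMap (f ≫ g) = homFunctorMap g ≫ homFunctorMap f := by
  rw [homFunctorMap, op_comp, Functor.map_comp]

theorem ev_ext {X : C} {F : C ⥤ AddCommGrpCat.{v}} {π π' : homFunctor X ⟶ F}
    (h : ev π (𝟙 X) = ev π' (𝟙 X)) : π = π' := by
  ext M g
  change X ⟶ M at g
  have := ev_comp π (𝟙 X) g
  have h2 := ev_comp π' (𝟙 X) g
  rw [Category.id_comp] at this h2
  exact this.trans ((congrArg _ h).trans h2.symm)

/-- A projective presentation `Hom(Y, -) ⟶ Hom(X, -) ⟶ F ⟶ 0` of `F` induced by a morphism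
`f : X ⟶ Y`. -/
structure ProjPres (F : C ⥤ AddCommGrpCat.{v}) where
  {X Y : C}
  f : X ⟶ Y
  π : homFunctor X ⟶ F
  exact : ∀ (M : C) (g : X ⟶ M), ev π g = 0 ↔ ∃ h : Y ⟶ M, f ≫ h = g
  surj : ∀ (M : C) (x : F.obj M), ∃ g : X ⟶ M, ev π g = x

theorem ProjPres.isFinitelyPresentedFunctor {F : C ⥤ AddCommGrpCat.{v}} (P : ProjPres F) :
    IsFinitelyPresentedFunctor F :=
  ⟨P.X, P.Y, homFunctorMap P.f, P.π, fun M => ⟨fun g => P.exact M g, fun x => P.surj M x⟩⟩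

theorem IsFinitelyPresentedFunctor.nonempty_projPres {F : C ⥤ AddCommGrpCat.{v}}
    (hF : IsFinitelyPresentedFunctor F) : Nonempty (ProjPres F) := by
  obtain ⟨X, Y, η, π, h⟩ := hF
  obtain ⟨f, rfl⟩ := preadditiveCoyoneda.map_surjective η
  exact ⟨⟨f.unop, π, fun M g => (h M).1 g, fun M x => (h M).2 x⟩⟩

/-- Any natural transformation lifts to projective presentations. -/
theorem ProjPres.exists_lift {F G : C ⥤ AddCommGrpCat.{v}} (P : ProjPres F) (Q : ProjPres G)
    (α : F ⟶ G) : ∃ φ : Q.X ⟶ P.X, homFunctorMap φ ≫ Q.π = P.π ≫ α := by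
  obtain ⟨φ, hφ⟩ := Q.surj P.X (ev (P.π ≫ α) (𝟙 _))
  exact ⟨φ, ev_ext (by rw [ev_homFunctorMap, Category.comp_id, hφ])⟩

theorem ProjPres.f_π {F : C ⥤ AddCommGrpCat.{v}} (P : ProjPres F) :
    homFunctorMap P.f ≫ P.π = 0 :=
  ev_ext (by rw [ev_homFunctorMap]; exact (P.exact _ _).2 ⟨_, rfl⟩)

/-- Such a lift is compatible with the morphisms inducing the presentations. -/
theorem ProjPres.exists_lift' {F G : C ⥤ AddCommGrpCat.{v}} (P : ProjPres F) (Q : ProjPres G)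
    {α : F ⟶ G} {φ : Q.X ⟶ P.X} (h : homFunctorMap φ ≫ Q.π = P.π ≫ α) :
    ∃ ψ : Q.Y ⟶ P.Y, Q.f ≫ ψ = φ ≫ P.f := by
  refine (Q.exact _ _).1 ?_
  have h1 : ev (homFunctorMap φ ≫ Q.π) P.f = ev (P.π ≫ α) P.f := by rw [h]
  rw [ev_homFunctorMap, ev_trans, (P.exact _ P.f).2 ⟨𝟙 _, Category.comp_id _⟩] at h1
  rw [h1, map_zero]

/-- Two lifts of the same natural transformation differ by a morphism through `Q.f`. -/
theorem ProjPres.lift_unique {F G : C ⥤ AddCommGrpCat.{v}} (P : ProjPres F) (Q : ProjPres G)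
    {φ φ' : Q.X ⟶ P.X} (h : homFunctorMap φ ≫ Q.π = homFunctorMap φ' ≫ Q.π) :
    ∃ s : Q.Y ⟶ P.X, Q.f ≫ s = φ - φ' := by
  refine (Q.exact _ _).1 ?_
  have h1 : ev (homFunctorMap φ ≫ Q.π) (𝟙 _) = ev (homFunctorMap φ' ≫ Q.π) (𝟙 _) := by rw [h]
  rw [ev_homFunctorMap, ev_homFunctorMap, Category.comp_id, Category.comp_id] at h1
  rw [ev_sub, h1, sub_self]

/-- The functor `Coker(Hom(f, -) : Hom(Y, -) ⟶ Hom(X, -))` with its tautological presentation. -/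
def cokerPres {X Y : C} (f : X ⟶ Y) : ProjPres (cokernel (homFunctorMap f)) where
  f := f
  π := cokernel.π _
  exact M g := cokernel_app_exact (homFunctorMap f) M g
  surj M x := cokernel_app_surjective (homFunctorMap f) M x

/-- If weak pushouts exist, the kernel of a morphism of finitely presented functors is again
finitely presented. -/
theorem kernel_isFinitelyPresentedFunctor
    (hC : ∀ {W X Y : C} (a : W ⟶ X) (b : W ⟶ Y), ∃ (Z : C) (i : X ⟶ Z) (j : Y ⟶ Z),
      a ≫ i = b ≫ j ∧ ∀ {M : C} (g : X ⟶ M) (h : Y ⟶ M), a ≫ g = b ≫ h →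
        ∃ z : Z ⟶ M, i ≫ z = g ∧ j ≫ z = h)
    {F G : C ⥤ AddCommGrpCat.{v}} (hF : IsFinitelyPresentedFunctor F)
    (hG : IsFinitelyPresentedFunctor G) (α : F ⟶ G) :
    IsFinitelyPresentedFunctor (kernel α) := by
  obtain ⟨P⟩ := hF.nonempty_projPres
  obtain ⟨Q⟩ := hG.nonempty_projPres
  obtain ⟨φ, hφ⟩ := P.exists_lift Q α
  obtain ⟨Z, i, j, hij, hZ⟩ := hC φ Q.f
  obtain ⟨W, k, l, hkl, hW⟩ := hC P.f i
  have h0 : (homFunctorMap i ≫ P.π) ≫ α = 0 := ev_ext (by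
    rw [Category.assoc, ← hφ, ev_homFunctorMap, ev_homFunctorMap, Category.comp_id, hij]
    exact (Q.exact _ _).2 ⟨_, rfl⟩)
  have key : ∀ {M : C} (z : Z ⟶ M),
      (kernel.ι α).app M (ev (kernel.lift α _ h0) z) = ev P.π (i ≫ z) := fun z => by
    rw [← ev_trans, kernel.lift_ι, ev_homFunctorMap]
  refine ProjPres.isFinitelyPresentedFunctor ⟨l, kernel.lift α _ h0, fun M z => ?_, fun M x => ?_⟩
  · rw [← (injective_iff_map_eq_zero' _).1 (kernel_app_injective α M), key, P.exact]
    constructor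
    · rintro ⟨y, hy⟩
      obtain ⟨w, -, hw⟩ := hW y z hy
      exact ⟨w, hw⟩
    · rintro ⟨w, rfl⟩
      exact ⟨k ≫ w, by rw [← Category.assoc, hkl, Category.assoc]⟩
  · obtain ⟨g, hg⟩ := P.surj M ((kernel.ι α).app M x)
    have h1 : ev Q.π (φ ≫ g) = 0 := by
      rw [← ev_homFunctorMap, hφ, ev_trans, hg]
      exact (kernel_app_exact α M _).2 ⟨x, rfl⟩
    obtain ⟨y, hy⟩ := (Q.exact _ _).1 h1
    obtain ⟨z, hz, -⟩ := hZ g y hy.symm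
    exact ⟨z, kernel_app_injective α M (by rw [key, hz, hg])⟩

/-- Replacing the morphism of a projective presentation by an isomorphic one. -/
def ProjPres.ofIso {F : C ⥤ AddCommGrpCat.{v}}
    (P : ProjPres F) {X Y : C} (f : X ⟶ Y) (e₁ : X ≅ P.X) (e₂ : Y ≅ P.Y)
    (h : f ≫ e₂.hom = e₁.hom ≫ P.f) : ProjPres F where
  f := f
  π := homFunctorMap e₁.inv ≫ P.π
  exact M g := by
    rw [ev_homFunctorMap, P.exact]
    constructor
    · rintro ⟨y, hy⟩
      refine ⟨e₂.hom ≫ y, ?_⟩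
      rw [← Category.assoc, h, Category.assoc, hy, e₁.hom_inv_id_assoc]
    · rintro ⟨y, rfl⟩
      refine ⟨e₂.inv ≫ y, ?_⟩
      have h' : e₁.inv ≫ f = P.f ≫ e₂.inv := by
        rw [Iso.inv_comp_eq, ← Category.assoc, ← h, Category.assoc, e₂.hom_inv_id,
          Category.comp_id]
      rw [← Category.assoc, ← h', Category.assoc]
  surj M x := by
    obtain ⟨g, hg⟩ := P.surj M x
    exact ⟨e₁.hom ≫ g, by rw [ev_homFunctorMap, e₁.inv_hom_id_assoc, hg]⟩

theorem ProjPres.isIso_desc  {F : C ⥤ AddCommGrpCat.{v}} (P : ProjPres F) :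
    IsIso (cokernel.desc (homFunctorMap P.f) P.π P.f_π) := by
  have key : ∀ (M : C) (g : P.X ⟶ M), (cokernel.desc (homFunctorMap P.f) P.π P.f_π).app M
      (ev (cokernel.π (homFunctorMap P.f)) g) = ev P.π g := fun M g => by
    rw [← ev_trans, cokernel.π_desc]
  refine (NatTrans.isIso_iff_isIso_app _).2 fun M => ?_
  rw [ConcreteCategory.isIso_iff_bijective]
  constructor
  · refine (injective_iff_map_eq_zero _).2 fun x hx => ?_
    obtain ⟨g, rfl⟩ := (cokerPres P.f).surj M x
    exact ((cokerPres P.f).exact M g).2 ((P.exact M g).1 ((key M g).symm.trans hx))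
  · intro x
    obtain ⟨g, rfl⟩ := P.surj M x
    exact ⟨_, key M g⟩

end FinitelyPresentedFunctors

section Adelman

/-- Three term chains `X₁ ⟶ X₂ ⟶ X₃` in a category (not necessarily complexes). -/
structure Chain (C : Type u) [Category.{v} C] where
  {X₁ X₂ X₃ : C}
  f₁ : X₁ ⟶ X₂
  f₂ : X₂ ⟶ X₃

variable {C : Type u} [Category.{v} C]

/-- Morphisms of three term chains: commutative diagrams `(α₁, α₂, α₃)`. -/
@[ext]
structure Chain.Hom (X Y : Chain C) where
  α₁ : X.X₁ ⟶ Y.X₁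
  α₂ : X.X₂ ⟶ Y.X₂
  α₃ : X.X₃ ⟶ Y.X₃
  comm₁ : X.f₁ ≫ α₂ = α₁ ≫ Y.f₁
  comm₂ : X.f₂ ≫ α₃ = α₂ ≫ Y.f₂

instance : Category (Chain C) where
  Hom := Chain.Hom
  id X := ⟨𝟙 _, 𝟙 _, 𝟙 _, by simp, by simp⟩
  comp α β := ⟨α.α₁ ≫ β.α₁, α.α₂ ≫ β.α₂, α.α₃ ≫ β.α₃,
    by rw [← Category.assoc, α.comm₁, Category.assoc, β.comm₁, Category.assoc],
    by rw [← Category.assoc, α.comm₂, Category.assoc, β.comm₂, Category.assoc]⟩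

@[simp] theorem Chain.id_α₂ (X : Chain C) : Chain.Hom.α₂ (𝟙 X) = 𝟙 X.X₂ := rfl

@[simp] theorem Chain.comp_α₂ {X Y Z : Chain C} (α : X ⟶ Y) (β : Y ⟶ Z) :
    Chain.Hom.α₂ (α ≫ β) = α.α₂ ≫ β.α₂ := rfl

variable [Preadditive C]

/-- Two chain morphisms are identified if their difference is null-homotopic, that is, if the
middle component of the difference is of the form `g₁ s + t f₂`. -/
def chainHomotopic : HomRel (Chain C) := fun X Y α β =>
  ∃ (s : X.X₂ ⟶ Y.X₁) (t : X.X₃ ⟶ Y.X₂), α.α₂ - β.α₂ = s ≫ Y.f₁ + X.f₂ ≫ t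

instance : Congruence (chainHomotopic (C := C)) where
  equivalence :=
    { refl := fun α => ⟨0, 0, by simp⟩
      symm := by
        rintro α β ⟨s, t, h⟩
        exact ⟨-s, -t, by rw [← neg_sub, h, Preadditive.neg_comp, Preadditive.comp_neg, neg_add]⟩
      trans := by
        rintro α β γ ⟨s, t, h⟩ ⟨s', t', h'⟩
        refine ⟨s + s', t + t', ?_⟩
        rw [← sub_add_sub_cancel, h, h', Preadditive.add_comp, Preadditive.comp_add]
        abel }
  comp_left := by
    rintro X Y Z α β β' ⟨s, t, h⟩
    refine ⟨α.α₂ ≫ s, α.α₃ ≫ t, ?_⟩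
    rw [Chain.comp_α₂, Chain.comp_α₂, ← Preadditive.comp_sub, h, Preadditive.comp_add,
      Category.assoc, ← Category.assoc X.f₂, α.comm₂, Category.assoc]
  comp_right := by
    rintro X Y Z α β γ ⟨s, t, h⟩
    refine ⟨s ≫ γ.α₁, t ≫ γ.α₂, ?_⟩
    rw [Chain.comp_α₂, Chain.comp_α₂, ← Preadditive.sub_comp, h, Preadditive.add_comp,
      Category.assoc, Category.assoc, γ.comm₁, Category.assoc]

variable (C) in
/-- Adelman's category: three term chains with chain morphisms modulo null-homotopic ones. -/
abbrev Adelman := CategoryTheory.Quotient (chainHomotopic (C := C))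

end Adelman

section Matrices

/-- The additive category with objects `A⁰, A¹, A², …`; the object `Aⁿ` is encoded by `n`. -/
structure FreeCat (A : Type u) where
  n : ℕ

variable (A : Type u) [Ring A]

/-- A morphism `Aⁿ ⟶ Aᵐ` is an `m × n` matrix, and composition is matrix multiplication. -/
instance : Category (FreeCat A) where
  Hom X Y := Matrix (Fin Y.n) (Fin X.n) A
  id X := (1 : Matrix (Fin X.n) (Fin X.n) A)
  comp {X Y Z} (U : Matrix (Fin Y.n) (Fin X.n) A) (V : Matrix (Fin Z.n) (Fin Y.n) A) := V * U
  id_comp U := Matrix.mul_one U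
  comp_id U := Matrix.one_mul U
  assoc U V W := (Matrix.mul_assoc W V U).symm

instance : Preadditive (FreeCat A) where
  homGroup X Y := inferInstanceAs (AddCommGroup (Matrix (Fin Y.n) (Fin X.n) A))
  add_comp _ _ _ U U' V := Matrix.mul_add V U U'
  comp_add _ _ _ U V V' := Matrix.add_mul V V' U

variable {A}

/-- The matrix of a morphism of `FreeCat A`. -/
def FreeCat.mat {X Y : FreeCat A} (U : X ⟶ Y) : Matrix (Fin Y.n) (Fin X.n) A := U

/-- The matrix `U` over `A`, acting on row vectors by right multiplication, is the transposed
matrix with entries in `Aᵐᵒᵖ`, acting on column vectors by left multiplication. -/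
def FreeCat.dual {X Y : FreeCat A} (U : X ⟶ Y) :
    (⟨Y.n⟩ : FreeCat Aᵐᵒᵖ) ⟶ ⟨X.n⟩ :=
  ((FreeCat.mat U).transpose.map MulOpposite.op : Matrix (Fin X.n) (Fin Y.n) Aᵐᵒᵖ)

theorem FreeCat.dual_id (X : FreeCat A) : FreeCat.dual (𝟙 X) = 𝟙 (⟨X.n⟩ : FreeCat Aᵐᵒᵖ) := by
  change ((1 : Matrix (Fin X.n) (Fin X.n) A).transpose.map MulOpposite.op) = 1
  rw [Matrix.transpose_one, Matrix.map_one _ rfl rfl]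

theorem FreeCat.dual_comp {X Y Z : FreeCat A} (U : X ⟶ Y) (V : Y ⟶ Z) :
    FreeCat.dual (U ≫ V) = FreeCat.dual V ≫ FreeCat.dual U := by
  change (FreeCat.mat V * FreeCat.mat U).transpose.map MulOpposite.op =
    (FreeCat.mat U).transpose.map MulOpposite.op * (FreeCat.mat V).transpose.map MulOpposite.op
  ext i j
  simp [Matrix.mul_apply]

theorem FreeCat.dual_add {X Y : FreeCat A} (U V : X ⟶ Y) :
    FreeCat.dual (U + V) = FreeCat.dual U + FreeCat.dual V := rfl

theorem FreeCat.dual_sub {X Y : FreeCat A} (U V : X ⟶ Y) :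
    FreeCat.dual (U - V) = FreeCat.dual U - FreeCat.dual V := rfl

/-- The contravariant functor on chains of matrices that reverses all arrows and replaces left
multiplication on columns by right multiplication on rows. -/
def chainDual (A : Type u) [Ring A] : (Chain (FreeCat A))ᵒᵖ ⥤ Chain (FreeCat Aᵐᵒᵖ) where
  obj X := ⟨FreeCat.dual X.unop.f₂, FreeCat.dual X.unop.f₁⟩
  map α :=
    { α₁ := FreeCat.dual α.unop.α₃
      α₂ := FreeCat.dual α.unop.α₂
      α₃ := FreeCat.dual α.unop.α₁
      comm₁ := by rw [← FreeCat.dual_comp, ← FreeCat.dual_comp, α.unop.comm₂]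
      comm₂ := by rw [← FreeCat.dual_comp, ← FreeCat.dual_comp, α.unop.comm₁] }
  map_id X := Chain.Hom.ext (FreeCat.dual_id _) (FreeCat.dual_id _) (FreeCat.dual_id _)
  map_comp α β :=
    Chain.Hom.ext (FreeCat.dual_comp _ _) (FreeCat.dual_comp _ _) (FreeCat.dual_comp _ _)

/-- The duality on Adelman's category induced by `chainDual`. -/
def dIII (A : Type u) [Ring A] : (Adelman (FreeCat A))ᵒᵖ ⥤ Adelman (FreeCat Aᵐᵒᵖ) :=
  (CategoryTheory.Quotient.lift _ (chainDual A ⋙ CategoryTheory.Quotient.functor _).rightOp (by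
    rintro X Y α β ⟨s, t, h⟩
    refine congrArg Quiver.Hom.op (CategoryTheory.Quotient.sound _
      ⟨FreeCat.dual t, FreeCat.dual s, ?_⟩)
    change FreeCat.dual α.α₂ - FreeCat.dual β.α₂ =
      FreeCat.dual t ≫ FreeCat.dual X.f₂ + FreeCat.dual Y.f₁ ≫ FreeCat.dual s
    rw [← FreeCat.dual_sub, h, FreeCat.dual_add, FreeCat.dual_comp, FreeCat.dual_comp,
      add_comm])).leftOp

end Matrices

section Modules

variable (A : Type u) [Ring A]

/-- The category `mod-A` of finitely presented right `A`-modules; right `A`-modules are modules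
over `Aᵐᵒᵖ`. -/
abbrev FPMod := ObjectProperty.FullSubcategory
  (fun M : ModuleCat.{u} Aᵐᵒᵖ => Module.FinitePresentation Aᵐᵒᵖ M)

/-- The category `mod-(mod-A)` of finitely presented functors `mod-A ⥤ Ab`. -/
abbrev FPFun := (IsFinitelyPresentedFunctor (C := FPMod A)).FullSubcategory

variable {A}

instance (X : FPMod A) : Module.FinitePresentation Aᵐᵒᵖ X.obj := X.property

/-- Bundle a finitely presented right module. -/
abbrev FPMod.of (M : Type u) [AddCommGroup M] [Module Aᵐᵒᵖ M] [Module.FinitePresentation Aᵐᵒᵖ M] :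
    FPMod A := ⟨ModuleCat.of Aᵐᵒᵖ M, inferInstance⟩

/-- Bundle a linear map. -/
abbrev FPMod.ofHom {X Y : FPMod A} (f : X.obj →ₗ[Aᵐᵒᵖ] Y.obj) : X ⟶ Y :=
  ObjectProperty.homMk (ModuleCat.ofHom f)

/-- The linear map underlying a morphism of `FPMod A`. -/
abbrev FPMod.lin {X Y : FPMod A} (f : X ⟶ Y) : X.obj →ₗ[Aᵐᵒᵖ] Y.obj := f.hom.hom

theorem FPMod.hom_ext {X Y : FPMod A} {f g : X ⟶ Y} (h : FPMod.lin f = FPMod.lin g) : f = g :=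
  ObjectProperty.hom_ext _ (ModuleCat.hom_ext h)

theorem FPMod.hom_ext' {X Y : FPMod A} {f g : X ⟶ Y}
    (h : ∀ x, FPMod.lin f x = FPMod.lin g x) : f = g :=
  FPMod.hom_ext (LinearMap.ext h)

theorem FPMod.lin_comp {X Y Z : FPMod A} (f : X ⟶ Y) (g : Y ⟶ Z) :
    FPMod.lin (f ≫ g) = FPMod.lin g ∘ₗ FPMod.lin f := rfl

/-- `Aⁿ` as a right module is isomorphic to `(Aᵐᵒᵖ)ⁿ`. -/
def opEquiv (n : ℕ) : (Fin n → A) ≃ₗ[Aᵐᵒᵖ] (Fin n → Aᵐᵒᵖ) where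
  toFun x i := MulOpposite.op (x i)
  invFun x i := MulOpposite.unop (x i)
  map_add' _ _ := rfl
  map_smul' _ _ := rfl
  left_inv _ := rfl
  right_inv _ := rfl

instance (n : ℕ) : Module.FinitePresentation Aᵐᵒᵖ (Fin n → A) :=
  Module.FinitePresentation.of_equiv (opEquiv n).symm

instance (n : ℕ) : Module.Projective Aᵐᵒᵖ (Fin n → A) :=
  Module.Projective.of_equiv (opEquiv n).symm

/-- The homomorphism `Aⁿ → Aᵐ` of right modules given by an `m × n` matrix acting from the left
on column vectors. -/
def colMap {X Y : FreeCat A} (U : X ⟶ Y) : (Fin X.n → A) →ₗ[Aᵐᵒᵖ] (Fin Y.n → A) :=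
  Matrix.mulVecBilin A Aᵐᵒᵖ (FreeCat.mat U)

theorem colMap_id (X : FreeCat A) : colMap (𝟙 X) = LinearMap.id :=
  LinearMap.ext fun x => Matrix.one_mulVec x

theorem colMap_comp {X Y Z : FreeCat A} (U : X ⟶ Y) (V : Y ⟶ Z) :
    colMap (U ≫ V) = colMap V ∘ₗ colMap U :=
  LinearMap.ext fun x => (Matrix.mulVec_mulVec x (FreeCat.mat V) (FreeCat.mat U)).symm

theorem colMap_add {X Y : FreeCat A} (U V : X ⟶ Y) : colMap (U + V) = colMap U + colMap V :=
  LinearMap.ext fun x => Matrix.add_mulVec (FreeCat.mat U) (FreeCat.mat V) x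

theorem colMap_sub {X Y : FreeCat A} (U V : X ⟶ Y) : colMap (U - V) = colMap U - colMap V :=
  LinearMap.ext fun x => Matrix.sub_mulVec (FreeCat.mat U) (FreeCat.mat V) x

theorem colMap_injective {X Y : FreeCat A} {U V : X ⟶ Y} (h : colMap U = colMap V) : U = V :=
  Matrix.ext_of_mulVec_single fun i => LinearMap.congr_fun h (Pi.single i 1)

theorem colMap_surjective {X Y : FreeCat A} (f : (Fin X.n → A) →ₗ[Aᵐᵒᵖ] (Fin Y.n → A)) :
    ∃ U : X ⟶ Y, colMap U = f := by
  refine ⟨(Matrix.of fun i j => f (Pi.single j 1) i : Matrix (Fin Y.n) (Fin X.n) A), ?_⟩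
  refine LinearMap.ext fun x => ?_
  have hx : x = ∑ j, MulOpposite.op (x j) • (Pi.single j 1 : Fin X.n → A) := by
    ext i
    simp [Finset.sum_apply, Pi.single_apply]
  conv_rhs => rw [hx, map_sum]
  ext i
  simp only [map_smul, Finset.sum_apply, Pi.smul_apply, MulOpposite.smul_eq_mul_unop]
  rfl

/-- The cokernel `Aⁿ / U Aᵐ` of a matrix. -/
def coker {X Y : FreeCat A} (U : X ⟶ Y) : FPMod A :=
  haveI : Module.FinitePresentation Aᵐᵒᵖ ((Fin Y.n → A) ⧸ LinearMap.range (colMap U)) :=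
    Module.finitePresentation_of_surjective (LinearMap.range (colMap U)).mkQ
      (Submodule.mkQ_surjective _) (by rw [Submodule.ker_mkQ]; exact Submodule.fg_range _)
  FPMod.of ((Fin Y.n → A) ⧸ LinearMap.range (colMap U))

/-- The projection of `Aⁿ` onto the cokernel. -/
def coker.proj {X Y : FreeCat A} (U : X ⟶ Y) : (Fin Y.n → A) →ₗ[Aᵐᵒᵖ] (coker U).obj :=
  (LinearMap.range (colMap U)).mkQ

theorem coker.proj_surjective {X Y : FreeCat A} (U : X ⟶ Y) :
    Function.Surjective (coker.proj U) := Submodule.mkQ_surjective _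

theorem coker.proj_eq_zero {X Y : FreeCat A} (U : X ⟶ Y) (x : Fin Y.n → A) :
    coker.proj U x = 0 ↔ ∃ y, colMap U y = x :=
  (Submodule.Quotient.mk_eq_zero _).trans Iff.rfl

/-- The morphism of cokernels induced by a commutative square. -/
def coker.map {X Y X' Y' : FreeCat A} (U : X ⟶ Y) (U' : X' ⟶ Y') (a : X ⟶ X') (b : Y ⟶ Y')
    (h : U ≫ b = a ≫ U') : coker U ⟶ coker U' :=
  FPMod.ofHom ((LinearMap.range (colMap U)).mapQ (LinearMap.range (colMap U')) (colMap b) (by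
    rintro _ ⟨y, rfl⟩
    refine ⟨colMap a y, ?_⟩
    rw [← LinearMap.comp_apply, ← LinearMap.comp_apply, ← colMap_comp, ← colMap_comp, h]))

theorem coker.map_proj {X Y X' Y' : FreeCat A} (U : X ⟶ Y) (U' : X' ⟶ Y') (a : X ⟶ X')
    (b : Y ⟶ Y') (h : U ≫ b = a ≫ U') (x : Fin Y.n → A) :
    FPMod.lin (coker.map U U' a b h) (coker.proj U x) = coker.proj U' (colMap b x) := rfl

theorem coker.hom_ext {X Y : FreeCat A} {U : X ⟶ Y} {Z : FPMod A} {f g : coker U ⟶ Z}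
    (h : ∀ x, FPMod.lin f (coker.proj U x) = FPMod.lin g (coker.proj U x)) : f = g :=
  FPMod.hom_ext' fun x => by
    obtain ⟨x, rfl⟩ := coker.proj_surjective U x
    exact h x

/-- Lifting a morphism of cokernels to free modules. -/
theorem coker.exists_lift {X Y X' Y' : FreeCat A} (U : X ⟶ Y) (U' : X' ⟶ Y')
    (φ : coker U ⟶ coker U') :
    ∃ b : Y ⟶ Y', ∀ x, FPMod.lin φ (coker.proj U x) = coker.proj U' (colMap b x) := by
  obtain ⟨b', hb⟩ := Module.projective_lifting_property (coker.proj U')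
      (FPMod.lin φ ∘ₗ coker.proj U) (coker.proj_surjective _)
  obtain ⟨b, rfl⟩ := colMap_surjective b'
  exact ⟨b, fun x => (LinearMap.congr_fun hb x).symm⟩

/-- A matrix whose columns vanish in the cokernel of `U` factors through `U`. -/
theorem coker.exists_factor {X Y Z : FreeCat A} (U : X ⟶ Y) (b : Z ⟶ Y)
    (h : ∀ x, coker.proj U (colMap b x) = 0) : ∃ a : Z ⟶ X, b = a ≫ U := by
  obtain ⟨s', hs'⟩ := Module.projective_lifting_property (LinearMap.rangeRestrict (colMap U))
      ((colMap b).codRestrict (LinearMap.range (colMap U))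
        fun x => (coker.proj_eq_zero _ _).1 (h x)) (LinearMap.surjective_rangeRestrict _)
  obtain ⟨s, rfl⟩ := colMap_surjective s'
  refine ⟨s, colMap_injective (LinearMap.ext fun x => ?_)⟩
  rw [colMap_comp]
  exact (congrArg Subtype.val (LinearMap.congr_fun hs' x)).symm

/-- For a chain `Aᵐ → Aⁿ → Aᵖ` given by `u` and `v`, the morphism `Coker u ⟶ Coker vu` induced
by `v`. -/
def chainMor (X : Chain (FreeCat A)) : coker X.f₁ ⟶ coker (X.f₁ ≫ X.f₂) :=
  coker.map X.f₁ (X.f₁ ≫ X.f₂) (𝟙 _) X.f₂ (by rw [Category.id_comp])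

/-- The morphism on `Coker u` induced by a morphism of chains. -/
def chainMap₁ {X Y : Chain (FreeCat A)} (α : X ⟶ Y) : coker X.f₁ ⟶ coker Y.f₁ :=
  coker.map _ _ α.α₁ α.α₂ α.comm₁

/-- The morphism on `Coker vu` induced by a morphism of chains. -/
def chainMap₂ {X Y : Chain (FreeCat A)} (α : X ⟶ Y) :
    coker (X.f₁ ≫ X.f₂) ⟶ coker (Y.f₁ ≫ Y.f₂) :=
  coker.map _ _ α.α₁ α.α₃ (by
    rw [Category.assoc, α.comm₂, ← Category.assoc, α.comm₁, Category.assoc])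

theorem chainMap_comm {X Y : Chain (FreeCat A)} (α : X ⟶ Y) :
    chainMor X ≫ chainMap₂ α = chainMap₁ α ≫ chainMor Y :=
  coker.hom_ext fun x => congrArg (coker.proj _) (by
    rw [← LinearMap.comp_apply, ← LinearMap.comp_apply, ← colMap_comp, ← colMap_comp, α.comm₂])

/-- The finitely presented functor attached to a chain `Aᵐ → Aⁿ → Aᵖ` given by `u` and `v`: the
cokernel of `Hom(Coker vu, -) ⟶ Hom(Coker u, -)`. -/
abbrev chainFun (X : Chain (FreeCat A)) : FPFun A :=
  ⟨cokernel (homFunctorMap (chainMor X)), (cokerPres (chainMor X)).isFinitelyPresentedFunctor⟩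

/-- The morphism of cokernels induced by a morphism of chains. -/
def chainFunMap {X Y : Chain (FreeCat A)} (α : X ⟶ Y) : chainFun Y ⟶ chainFun X :=
  ObjectProperty.homMk (cokernel.map (homFunctorMap (chainMor Y)) (homFunctorMap (chainMor X))
    (homFunctorMap (chainMap₂ α)) (homFunctorMap (chainMap₁ α)) (by
      rw [← Functor.map_comp, ← Functor.map_comp, ← op_comp, ← op_comp, chainMap_comm]))

theorem chainFunMap_π {X Y : Chain (FreeCat A)} (α : X ⟶ Y) :
    cokernel.π (homFunctorMap (chainMor Y)) ≫ (chainFunMap α).hom =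
      homFunctorMap (chainMap₁ α) ≫ cokernel.π (homFunctorMap (chainMor X)) :=
  cokernel.π_desc _ _ _

/-- Morphisms out of `chainFun` are determined by their composition with the projection. -/
theorem chainFun_hom_ext {X : Chain (FreeCat A)} {F : FPFun A} {a b : chainFun X ⟶ F}
    (h : cokernel.π (homFunctorMap (chainMor X)) ≫ a.hom = cokernel.π (homFunctorMap (chainMor X)) ≫ b.hom) : a = b :=
  ObjectProperty.hom_ext _ (coequalizer.hom_ext h)

theorem chainFunMap_eq_iff {X Y : Chain (FreeCat A)} (α β : X ⟶ Y) :
    chainFunMap α = chainFunMap β ↔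
      ∃ s : coker (X.f₁ ≫ X.f₂) ⟶ coker Y.f₁, chainMor X ≫ s = chainMap₁ α - chainMap₁ β := by
  constructor
  · intro h
    have h1 : homFunctorMap (chainMap₁ α) ≫ cokernel.π (homFunctorMap (chainMor X)) =
        homFunctorMap (chainMap₁ β) ≫ cokernel.π (homFunctorMap (chainMor X)) := by
      rw [← chainFunMap_π, ← chainFunMap_π, h]
    exact (cokerPres (chainMor Y)).lift_unique (cokerPres (chainMor X)) h1
  · rintro ⟨s, hs⟩
    refine chainFun_hom_ext ?_
    rw [chainFunMap_π, chainFunMap_π]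
    refine ev_ext ?_
    rw [ev_homFunctorMap, ev_homFunctorMap, ← sub_eq_zero, ← ev_sub, Category.comp_id,
      Category.comp_id, ← hs]
    exact ((cokerPres (chainMor X)).exact _ _).2 ⟨s, rfl⟩

/-- Chain morphisms induce the same morphism of functors exactly if they are homotopic. -/
theorem chainFunMap_eq_iff_homotopic {X Y : Chain (FreeCat A)} (α β : X ⟶ Y) :
    chainFunMap α = chainFunMap β ↔ chainHomotopic α β := by
  rw [chainFunMap_eq_iff]
  constructor
  · rintro ⟨r, hr⟩
    obtain ⟨t', ht'⟩ := Module.projective_lifting_property (coker.proj Y.f₁)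
      (FPMod.lin r ∘ₗ coker.proj (X.f₁ ≫ X.f₂)) (coker.proj_surjective _)
    obtain ⟨t, rfl⟩ := colMap_surjective t'
    have h1 : ∀ x, coker.proj Y.f₁ ((colMap (α.α₂ - β.α₂ - X.f₂ ≫ t)) x) = 0 := fun x => by
      have h2 : FPMod.lin r (coker.proj (X.f₁ ≫ X.f₂) (colMap X.f₂ x)) =
          coker.proj Y.f₁ (colMap α.α₂ x) - coker.proj Y.f₁ (colMap β.α₂ x) :=
        congr(FPMod.lin $hr (coker.proj X.f₁ x))
      rw [colMap_sub, colMap_sub, colMap_comp, LinearMap.sub_apply, LinearMap.sub_apply, map_sub,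
        map_sub, ← h2, LinearMap.comp_apply, ← LinearMap.comp_apply (coker.proj Y.f₁), ht']
      exact sub_self _
    obtain ⟨s, hs⟩ := coker.exists_factor _ _ h1
    exact ⟨s, t, by rw [← hs, sub_add_cancel]⟩
  · rintro ⟨s, t, h⟩
    have h0 : ∀ y, coker.proj Y.f₁ (colMap t (colMap (X.f₁ ≫ X.f₂) y)) = 0 := fun y => by
      have h3 : X.f₁ ≫ X.f₂ ≫ t = (α.α₁ - β.α₁ - X.f₁ ≫ s) ≫ Y.f₁ := by
        have h4 := congrArg (X.f₁ ≫ ·) h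
        simp only [Preadditive.comp_sub, Preadditive.comp_add, α.comm₁, β.comm₁] at h4
        rw [Preadditive.sub_comp, Preadditive.sub_comp, h4, Category.assoc, add_sub_cancel_left]
      rw [← LinearMap.comp_apply (colMap t), ← colMap_comp, Category.assoc, h3, colMap_comp]
      exact (coker.proj_eq_zero _ _).2 ⟨_, rfl⟩
    refine ⟨FPMod.ofHom ((LinearMap.range (colMap (X.f₁ ≫ X.f₂))).liftQ
      (coker.proj Y.f₁ ∘ₗ colMap t) ?_), coker.hom_ext fun x => ?_⟩
    · rintro _ ⟨y, rfl⟩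
      exact h0 y
    · change coker.proj Y.f₁ (colMap t (colMap X.f₂ x)) =
        coker.proj Y.f₁ (colMap α.α₂ x) - coker.proj Y.f₁ (colMap β.α₂ x)
      rw [← map_sub, ← LinearMap.sub_apply, ← colMap_sub, h, colMap_add, LinearMap.add_apply,
        map_add, colMap_comp, colMap_comp]
      exact ((congrArg (· + _) ((coker.proj_eq_zero _ _).2 ⟨_, rfl⟩)).trans (zero_add _)).symm

/-- The functor on chains given by `chainFun`. -/
def chainFunctor (A : Type u) [Ring A] : Chain (FreeCat A) ⥤ (FPFun A)ᵒᵖ where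
  obj X := op (chainFun X)
  map α := (chainFunMap α).op
  map_id X := congrArg Quiver.Hom.op (chainFun_hom_ext (by
    rw [chainFunMap_π]
    have : chainMap₁ (𝟙 X) = 𝟙 _ := coker.hom_ext fun x => by
      change coker.proj _ (colMap (𝟙 _) x) = _
      rw [colMap_id]; rfl
    rw [this]
    rfl))
  map_comp α β := congrArg Quiver.Hom.op (chainFun_hom_ext (by
    have : chainMap₁ (α ≫ β) = chainMap₁ α ≫ chainMap₁ β := coker.hom_ext fun x => by
      change coker.proj _ (colMap (α.α₂ ≫ β.α₂) x) = _
      rw [colMap_comp]; rfl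
    change _ = _ ≫ (chainFunMap β).hom ≫ (chainFunMap α).hom
    rw [chainFunMap_π, ← Category.assoc, chainFunMap_π,
      Category.assoc, chainFunMap_π, this, homFunctorMap_comp, Category.assoc]))

/-- The functor `𝔨⁻¹` from Adelman's category to `(mod-(mod-A))ᵒᵖ`. -/
def kInv (A : Type u) [Ring A] : Adelman (FreeCat A) ⥤ (FPFun A)ᵒᵖ :=
  CategoryTheory.Quotient.lift _ (chainFunctor A) fun _ _ α β h =>
    congrArg Quiver.Hom.op ((chainFunMap_eq_iff_homotopic α β).2 h)

instance : (kInv A).Faithful where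
  map_injective {X Y} := by
    rintro ⟨α⟩ ⟨β⟩ h
    exact CategoryTheory.Quotient.sound _
      ((chainFunMap_eq_iff_homotopic α β).1 (congrArg Quiver.Hom.unop h))

instance : (kInv A).Full where
  map_surjective {X Y} := by
    intro θ
    obtain ⟨X⟩ := X
    obtain ⟨Y⟩ := Y
    change op (chainFun X) ⟶ op (chainFun Y) at θ
    let P := cokerPres (chainMor X)
    let Q := cokerPres (chainMor Y)
    obtain ⟨φ, hφ⟩ := Q.exists_lift P θ.unop.hom
    obtain ⟨ψ, hψ⟩ := Q.exists_lift' P hφ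
    change coker X.f₁ ⟶ coker Y.f₁ at φ
    change coker (X.f₁ ≫ X.f₂) ⟶ coker (Y.f₁ ≫ Y.f₂) at ψ
    change chainMor X ≫ ψ = φ ≫ chainMor Y at hψ
    obtain ⟨b, hb⟩ := coker.exists_lift _ _ φ
    obtain ⟨c, hc⟩ := coker.exists_lift _ _ ψ
    obtain ⟨w, hw⟩ := coker.exists_factor (Y.f₁ ≫ Y.f₂) (X.f₂ ≫ c - b ≫ Y.f₂) fun x => by
      have h1 : FPMod.lin ψ (coker.proj (X.f₁ ≫ X.f₂) (colMap X.f₂ x)) =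
          FPMod.lin (chainMor Y) (FPMod.lin φ (coker.proj X.f₁ x)) :=
        congr(FPMod.lin $hψ (coker.proj X.f₁ x))
      rw [hb, hc] at h1
      rw [colMap_sub, LinearMap.sub_apply, map_sub, colMap_comp, colMap_comp, LinearMap.comp_apply,
        h1]
      exact sub_self _
    have hb' : ∀ x, FPMod.lin φ (coker.proj X.f₁ x) =
        coker.proj Y.f₁ (colMap (b + w ≫ Y.f₁) x) := fun x => by
      rw [hb, colMap_add, LinearMap.add_apply, map_add, colMap_comp]
      exact ((congrArg (_ + ·) ((coker.proj_eq_zero _ _).2 ⟨_, rfl⟩)).trans (add_zero _)).symm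
    obtain ⟨a, ha⟩ := coker.exists_factor Y.f₁ (X.f₁ ≫ (b + w ≫ Y.f₁)) fun x => by
      rw [colMap_comp, LinearMap.comp_apply, ← hb', (coker.proj_eq_zero _ _).2 ⟨x, rfl⟩, map_zero]
    let α : X ⟶ Y := ⟨a, b + w ≫ Y.f₁, c, ha, by
      rw [Preadditive.add_comp, Category.assoc, ← hw, add_sub_cancel]⟩
    have hα : chainMap₁ α = φ := coker.hom_ext fun x => (hb' x).symm
    refine ⟨(CategoryTheory.Quotient.functor _).map α, Quiver.Hom.unop_inj (chainFun_hom_ext ?_)⟩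
    refine (chainFunMap_π α).trans ?_
    rw [hα]
    exact hφ

/-- A module presented by a matrix is isomorphic to its cokernel. -/
def coker.iso {X Y : FreeCat A} (U : X ⟶ Y) {M : FPMod A} (p : (Fin Y.n → A) →ₗ[Aᵐᵒᵖ] M.obj)
    (hp : Function.Surjective p) (h : LinearMap.range (colMap U) = LinearMap.ker p) :
    coker U ≅ M :=
  ObjectProperty.isoMk _ (LinearEquiv.toModuleIso
    ((Submodule.quotEquivOfEq _ _ h).trans (p.quotKerEquivOfSurjective hp)))

theorem coker.iso_proj {X Y : FreeCat A} (U : X ⟶ Y) {M : FPMod A}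
    (p : (Fin Y.n → A) →ₗ[Aᵐᵒᵖ] M.obj)
    (hp : Function.Surjective p) (h : LinearMap.range (colMap U) = LinearMap.ker p)
    (x : Fin Y.n → A) : FPMod.lin (coker.iso U p hp h).hom (coker.proj U x) = p x := rfl

theorem exists_matrix_of_fg {Y : FreeCat A} (K : Submodule Aᵐᵒᵖ (Fin Y.n → A)) (hK : K.FG) :
    ∃ (X : FreeCat A) (U : X ⟶ Y), LinearMap.range (colMap U) = K := by
  obtain ⟨m, g, hg⟩ := K.fg_iff_exists_fin_linearMap.mp hK
  obtain ⟨U, hU⟩ := colMap_surjective (X := ⟨m⟩) (Y := Y) (g ∘ₗ (opEquiv m).toLinearMap)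
  refine ⟨⟨m⟩, U, ?_⟩
  rw [hU, LinearMap.range_comp_of_range_eq_top _ (LinearEquiv.range _), hg]

theorem FPMod.exists_pres (M : FPMod A) :
    ∃ (X Y : FreeCat A) (U : X ⟶ Y) (p : (Fin Y.n → A) →ₗ[Aᵐᵒᵖ] M.obj),
      Function.Surjective p ∧ LinearMap.range (colMap U) = LinearMap.ker p := by
  obtain ⟨n, m, f, g, hf, -⟩ := Module.FinitePresentation.exists_fin' Aᵐᵒᵖ M.obj
  let p := f ∘ₗ (opEquiv n).toLinearMap
  have hp : Function.Surjective p := hf.comp (opEquiv n).surjective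
  obtain ⟨X, U, hU⟩ := exists_matrix_of_fg (Y := ⟨n⟩) (LinearMap.ker p)
    (Module.FinitePresentation.fg_ker p hp)
  exact ⟨X, ⟨n⟩, U, p, hp, hU⟩

instance : (kInv A).EssSurj where
  mem_essImage F := by
    obtain ⟨P⟩ := F.unop.property.nonempty_projPres
    obtain ⟨-, N, -, p, hp, -⟩ := P.X.exists_pres
    obtain ⟨K, L, D, q, hq, hD⟩ := P.Y.exists_pres
    obtain ⟨c, hc⟩ := Module.projective_lifting_property q (FPMod.lin P.f ∘ₗ p) hq
    let a : (Fin (N.n + K.n) → A) →ₗ[Aᵐᵒᵖ] (Fin N.n → A) :=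
      LinearMap.funLeft Aᵐᵒᵖ A (Fin.castAdd K.n)
    let b : (Fin (N.n + K.n) → A) →ₗ[Aᵐᵒᵖ] (Fin K.n → A) :=
      LinearMap.funLeft Aᵐᵒᵖ A (Fin.natAdd N.n)
    have hab : ∀ x y, ∃ z, a z = x ∧ b z = y := fun x y =>
      ⟨Fin.append x y, funext fun i => Fin.append_left x y i,
        funext fun i => Fin.append_right x y i⟩
    have hpa : Function.Surjective (p ∘ₗ a) :=
      hp.comp fun x => (hab x 0).imp fun _ h => h.1
    obtain ⟨M, U, hU⟩ := exists_matrix_of_fg (Y := ⟨N.n + K.n⟩) (LinearMap.ker (p ∘ₗ a))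
      (Module.FinitePresentation.fg_ker _ hpa)
    obtain ⟨V, hV⟩ := colMap_surjective (X := ⟨N.n + K.n⟩) (Y := L) (c ∘ₗ a - colMap D ∘ₗ b)
    have hqD : ∀ y, q (colMap D y) = 0 := fun y =>
      LinearMap.mem_ker.1 (hD ▸ LinearMap.mem_range_self _ y)
    have hqc : ∀ x, q (c x) = FPMod.lin P.f (p x) := LinearMap.congr_fun hc
    have hqV : ∀ z, q (colMap V z) = FPMod.lin P.f (p (a z)) := fun z => by
      rw [hV, LinearMap.sub_apply, map_sub, LinearMap.comp_apply, LinearMap.comp_apply, hqD,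
        sub_zero, hqc]
    have hUV : LinearMap.range (colMap (U ≫ V)) = LinearMap.ker q := by
      rw [colMap_comp, LinearMap.range_comp, hU]
      ext y
      constructor
      · rintro ⟨z, hz, rfl⟩
        rw [LinearMap.mem_ker, hqV, show p (a z) = 0 from hz, map_zero]
      · intro hy
        obtain ⟨w, rfl⟩ : y ∈ LinearMap.range (colMap D) := hD ▸ hy
        obtain ⟨z, hz, hz'⟩ := hab 0 (-w)
        refine ⟨z, ?_, ?_⟩
        · change p (a z) = 0
          rw [hz, map_zero]
        · rw [hV, LinearMap.sub_apply, LinearMap.comp_apply, LinearMap.comp_apply, hz, hz',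
            map_zero, map_neg, zero_sub, neg_neg]
    let X : Chain (FreeCat A) := ⟨U, V⟩
    let P' : ProjPres F.unop.obj := P.ofIso (chainMor X) (coker.iso U _ hpa hU)
      (coker.iso (U ≫ V) q hq hUV) (coker.hom_ext fun x => hqV x)
    have := P'.isIso_desc
    exact ⟨⟨X⟩, ⟨(ObjectProperty.isoMk _ (asIso (cokernel.desc _ P'.π P'.f_π)).symm :
      F.unop ≅ chainFun X).op⟩⟩

instance : (kInv A).IsEquivalence where

/-- The equivalence `𝔨 : (mod-(mod-A))ᵒᵖ ⥤ III(𝔸)`, the quasi-inverse of `𝔨⁻¹`. -/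
def k (A : Type u) [Ring A] : (FPFun A)ᵒᵖ ⥤ Adelman (FreeCat A) := (kInv A).inv

instance : (k A).IsEquivalence := inferInstanceAs (kInv A).inv.IsEquivalence

end Modules

section Tensor

open TensorProduct

variable {A : Type u} [Ring A]

/-- The subgroup of `X ⊗_ℤ N` generated by the elements `xa ⊗ n - x ⊗ an`, for a right
`A`-module `X` and a left `A`-module `N` (a right module over `Aᵐᵒᵖ`). -/
def balanced (X : Type u) [AddCommGroup X] [Module Aᵐᵒᵖ X]
    (N : Type u) [AddCommGroup N] [Module Aᵐᵒᵖᵐᵒᵖ N] : Submodule ℤ (X ⊗[ℤ] N) :=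
  Submodule.span ℤ {t | ∃ (x : X) (a : A) (n : N),
    t = (MulOpposite.op a • x) ⊗ₜ[ℤ] n - x ⊗ₜ[ℤ] (MulOpposite.op (MulOpposite.op a) • n)}

/-- The tensor product `X ⊗_A N`, an abelian group. -/
abbrev Ten (X : FPMod A) (N : FPMod Aᵐᵒᵖ) : Type u :=
  (X.obj ⊗[ℤ] N.obj) ⧸ balanced (A := A) X.obj N.obj

/-- The element `x ⊗ n` of `X ⊗_A N`. -/
def Ten.tmul {X : FPMod A} {N : FPMod Aᵐᵒᵖ} (x : X.obj) (n : N.obj) : Ten X N :=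
  Submodule.Quotient.mk (x ⊗ₜ[ℤ] n)

theorem Ten.add_tmul {X : FPMod A} {N : FPMod Aᵐᵒᵖ} (x y : X.obj) (n : N.obj) :
    Ten.tmul (x + y) n = Ten.tmul x n + Ten.tmul y n :=
  congrArg Submodule.Quotient.mk (TensorProduct.add_tmul x y n)

theorem Ten.tmul_add {X : FPMod A} {N : FPMod Aᵐᵒᵖ} (x : X.obj) (n m : N.obj) :
    Ten.tmul x (n + m) = Ten.tmul x n + Ten.tmul x m :=
  congrArg Submodule.Quotient.mk (TensorProduct.tmul_add x n m)

theorem Ten.zero_tmul {X : FPMod A} {N : FPMod Aᵐᵒᵖ} (n : N.obj) :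
    Ten.tmul (0 : X.obj) n = 0 :=
  congrArg Submodule.Quotient.mk (TensorProduct.zero_tmul X.obj n)

theorem Ten.sum_tmul {X : FPMod A} {N : FPMod Aᵐᵒᵖ} {ι : Type} (s : Finset ι) (x : ι → X.obj)
    (n : N.obj) : Ten.tmul (∑ i ∈ s, x i) n = ∑ i ∈ s, Ten.tmul (x i) n :=
  map_sum (AddMonoidHom.mk' (fun x : X.obj => Ten.tmul x n) fun x y => Ten.add_tmul x y n) x s

theorem Ten.tmul_sum {X : FPMod A} {N : FPMod Aᵐᵒᵖ} {ι : Type} (s : Finset ι) (x : X.obj)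
    (n : ι → N.obj) : Ten.tmul x (∑ i ∈ s, n i) = ∑ i ∈ s, Ten.tmul x (n i) :=
  map_sum (AddMonoidHom.mk' (fun n : N.obj => Ten.tmul x n) fun m n => Ten.tmul_add x m n) n s

theorem Ten.smul_tmul {X : FPMod A} {N : FPMod Aᵐᵒᵖ} (a : A) (x : X.obj) (n : N.obj) :
    Ten.tmul (MulOpposite.op a • x) n =
      Ten.tmul x (MulOpposite.op (MulOpposite.op a) • n) :=
  (Submodule.Quotient.eq _).2 (Submodule.subset_span ⟨x, a, n, rfl⟩)

theorem Ten.hom_ext {X : FPMod A} {N : FPMod Aᵐᵒᵖ} {G : Type u} [AddCommGroup G]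
    {f g : Ten X N →+ G} (h : ∀ x n, f (Ten.tmul x n) = g (Ten.tmul x n)) : f = g := by
  ext t
  obtain ⟨t, rfl⟩ := Submodule.Quotient.mk_surjective _ t
  induction t with
  | zero => rw [Submodule.Quotient.mk_zero, map_zero, map_zero]
  | add x y hx hy => rw [Submodule.Quotient.mk_add, map_add, map_add, hx, hy]
  | tmul x n => exact h x n

/-- The homomorphism out of `X ⊗_A N` given by a balanced biadditive map. -/
def Ten.lift {X : FPMod A} {N : FPMod Aᵐᵒᵖ} {G : Type u} [AddCommGroup G]
    (b : X.obj →+ N.obj →+ G)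
    (hb : ∀ x (a : A) n, b (MulOpposite.op a • x) n =
      b x (MulOpposite.op (MulOpposite.op a) • n)) : Ten X N →+ G :=
  ((balanced (A := A) X.obj N.obj).liftQ (TensorProduct.liftAddHom b
    (fun r x n => by rw [map_zsmul, map_zsmul]; rfl)).toIntLinearMap (by
      refine Submodule.span_le.2 ?_
      rintro _ ⟨x, a, n, rfl⟩
      rw [SetLike.mem_coe, LinearMap.mem_ker, map_sub]
      exact sub_eq_zero.2 (hb x a n))).toAddMonoidHom

theorem Ten.lift_tmul {X : FPMod A} {N : FPMod Aᵐᵒᵖ} {G : Type u} [AddCommGroup G]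
    (b : X.obj →+ N.obj →+ G) (hb) (x : X.obj) (n : N.obj) :
    Ten.lift b hb (Ten.tmul x n) = b x n := rfl

/-- The homomorphism `f ⊗ g : X ⊗_A N → Y ⊗_A M`. -/
def Ten.map {X Y : FPMod A} {N M : FPMod Aᵐᵒᵖ} (f : X ⟶ Y) (g : N ⟶ M) : Ten X N →+ Ten Y M :=
  Ten.lift
    (AddMonoidHom.mk' (fun x => AddMonoidHom.mk' (fun n => Ten.tmul (FPMod.lin f x) (FPMod.lin g n))
        fun n m => (congrArg (Ten.tmul (FPMod.lin f x)) (map_add (FPMod.lin g) n m)).trans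
          (Ten.tmul_add _ _ _))
      fun x y => AddMonoidHom.ext fun n =>
        (congrArg (fun z => Ten.tmul z (FPMod.lin g n)) (map_add (FPMod.lin f) x y)).trans
          (Ten.add_tmul _ _ _))
    fun x a n => by
      change Ten.tmul (FPMod.lin f (MulOpposite.op a • x)) (FPMod.lin g n) =
        Ten.tmul (FPMod.lin f x) (FPMod.lin g (MulOpposite.op (MulOpposite.op a) • n))
      rw [map_smul, map_smul, Ten.smul_tmul]

theorem Ten.map_tmul {X Y : FPMod A} {N M : FPMod Aᵐᵒᵖ} (f : X ⟶ Y) (g : N ⟶ M) (x : X.obj)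
    (n : N.obj) : Ten.map f g (Ten.tmul x n) = Ten.tmul (FPMod.lin f x) (FPMod.lin g n) := rfl

variable (A) in
/-- The functor sending `X` to the functor `X ⊗_A -` on finitely presented left `A`-modules. -/
def tensorFunctor : FPMod A ⥤ FPMod Aᵐᵒᵖ ⥤ AddCommGrpCat.{u} where
  obj X :=
    { obj := fun N => AddCommGrpCat.of (Ten X N)
      map := fun g => AddCommGrpCat.ofHom (Ten.map (𝟙 X) g)
      map_id := fun _ => AddCommGrpCat.hom_ext (Ten.hom_ext fun _ _ => rfl)
      map_comp := fun _ _ => AddCommGrpCat.hom_ext (Ten.hom_ext fun _ _ => rfl) }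
  map f :=
    { app := fun N => AddCommGrpCat.ofHom (Ten.map f (𝟙 N))
      naturality := fun _ _ _ => AddCommGrpCat.hom_ext (Ten.hom_ext fun _ _ => rfl) }
  map_id _ := NatTrans.ext (funext fun _ => AddCommGrpCat.hom_ext (Ten.hom_ext fun _ _ => rfl))
  map_comp _ _ := NatTrans.ext (funext fun _ => AddCommGrpCat.hom_ext (Ten.hom_ext fun _ _ => rfl))

instance : (tensorFunctor A).Additive where
  map_add {_ _ f g} := NatTrans.ext (funext fun _ => AddCommGrpCat.hom_ext
    (Ten.hom_ext fun x n => Ten.add_tmul (FPMod.lin f x) (FPMod.lin g x) n))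

/-- The homomorphism `(Aᵐᵒᵖ)ⁿ → N` that sends the basis vectors to `y₁, …, yₙ`. -/
def ofVec {n : ℕ} {N : FPMod Aᵐᵒᵖ} (y : Fin n → N.obj) :
    (Fin n → Aᵐᵒᵖ) →ₗ[Aᵐᵒᵖᵐᵒᵖ] N.obj where
  toFun z := ∑ i, MulOpposite.op (z i) • y i
  map_add' z w := by simp [add_smul, Finset.sum_add_distrib]
  map_smul' a z := by
    simp only [Finset.smul_sum, smul_smul, RingHom.id_apply]
    rfl

theorem ofVec_single {n : ℕ} {N : FPMod Aᵐᵒᵖ} (y : Fin n → N.obj) (i : Fin n) :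
    ofVec y (Pi.single i 1) = y i := by
  change ∑ j, MulOpposite.op ((Pi.single i 1 : Fin n → Aᵐᵒᵖ) j) • y j = y i
  rw [Finset.sum_eq_single i]
  · rw [Pi.single_eq_same, MulOpposite.op_one, one_smul]
  · intro j _ h
    rw [Pi.single_eq_of_ne h, MulOpposite.op_zero, zero_smul]
  · exact fun h => absurd (Finset.mem_univ i) h

theorem ofVec_self {n : ℕ} {N : FPMod Aᵐᵒᵖ} (h : (Fin n → Aᵐᵒᵖ) →ₗ[Aᵐᵒᵖᵐᵒᵖ] N.obj) :
    ofVec (fun i => h (Pi.single i 1)) = h := by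
  refine LinearMap.ext fun z => ?_
  have hz : z = ∑ j, MulOpposite.op (z j) • (Pi.single j 1 : Fin n → Aᵐᵒᵖ) := by
    ext i
    simp [Finset.sum_apply, Pi.single_apply]
  conv_rhs => rw [hz, map_sum]
  simp only [map_smul]
  rfl

/-- For a finitely presented right module `X`, the functor `X ⊗_A -` is finitely presented. -/
theorem tensor_isFinitelyPresentedFunctor (X : FPMod A) :
    IsFinitelyPresentedFunctor ((tensorFunctor A).obj X) := by
  obtain ⟨M, L, U, p, hp, hU⟩ := X.exists_pres
  let R : FPMod Aᵐᵒᵖ := FPMod.of (Fin L.n → Aᵐᵒᵖ)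
  let S : FPMod Aᵐᵒᵖ := FPMod.of (Fin M.n → Aᵐᵒᵖ)
  let f : R ⟶ S := FPMod.ofHom (colMap (FreeCat.dual U))
  let e : Fin L.n → X.obj := fun i => p (Pi.single i 1)
  let π : homFunctor R ⟶ (tensorFunctor A).obj X :=
    { app := fun N => AddCommGrpCat.ofHom (AddMonoidHom.mk'
        (fun h : R ⟶ N => (∑ i, Ten.tmul (e i) (FPMod.lin h (Pi.single i 1)) : Ten X N))
        fun h h' => by
          rw [← Finset.sum_add_distrib]
          exact Finset.sum_congr rfl fun i _ => Ten.tmul_add _ _ _)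
      naturality := fun N N' g => by
        refine AddCommGrpCat.hom_ext (AddMonoidHom.ext fun h => ?_)
        exact (map_sum (Ten.map (𝟙 X) g)
          (fun i => Ten.tmul (e i) (FPMod.lin (show R ⟶ N from h) (Pi.single i 1)))
          Finset.univ).symm }
  have hπ : ∀ {N : FPMod Aᵐᵒᵖ} (h : R ⟶ N), ev π h =
    (∑ i, Ten.tmul (e i) (FPMod.lin h (Pi.single i 1)) : Ten X N) := fun h => rfl
  have hpe : ∀ c, p c = ∑ i, MulOpposite.op (c i) • e i := fun c => by
    have hc : c = ∑ j, MulOpposite.op (c j) • (Pi.single j 1 : Fin L.n → A) := by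
      ext i
      simp [Finset.sum_apply, Pi.single_apply]
    conv_lhs => rw [hc, map_sum]
    simp only [map_smul]
    rfl
  have hf : ∀ i j, colMap (FreeCat.dual U) (Pi.single i 1) j = MulOpposite.op (FreeCat.mat U i j) :=
    fun i j => congrFun (Matrix.mulVec_single_one (FreeCat.mat (FreeCat.dual U)) i) j
  have hUj : ∀ i j, colMap U (Pi.single j 1) i = FreeCat.mat U i j :=
    fun i j => congrFun (Matrix.mulVec_single_one (FreeCat.mat U) j) i
  refine ProjPres.isFinitelyPresentedFunctor ⟨f, π, fun N h => ⟨fun h0 => ?_, ?_⟩, fun N x => ?_⟩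
  · -- the map `Nᵐ → Nⁿ` given by `U`
    let u : (Fin M.n → N.obj) →+ (Fin L.n → N.obj) := AddMonoidHom.mk'
      (fun y i => ∑ j, MulOpposite.op (MulOpposite.op (FreeCat.mat U i j)) • y j)
      fun y y' => funext fun i => by simp [Finset.sum_add_distrib]
    let Q := (Fin L.n → N.obj) ⧸ u.range
    let b : (Fin L.n → A) →+ N.obj →+ Q := AddMonoidHom.mk'
      (fun c => AddMonoidHom.mk'
        (fun y => QuotientAddGroup.mk fun i => MulOpposite.op (MulOpposite.op (c i)) • y)
        fun y y' => by
          rw [← QuotientAddGroup.mk_add]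
          exact congrArg _ (funext fun i => smul_add _ _ _))
      fun c c' => AddMonoidHom.ext fun y => congrArg QuotientAddGroup.mk
        (funext fun i => add_smul (MulOpposite.op (MulOpposite.op (c i)))
          (MulOpposite.op (MulOpposite.op (c' i))) y)
    have hb : p.toAddMonoidHom.ker ≤ b.ker := fun c hc => by
      obtain ⟨w, rfl⟩ : c ∈ LinearMap.range (colMap U) := by rw [hU]; exact hc
      refine AddMonoidHom.ext fun y => (QuotientAddGroup.eq_zero_iff _).2
        ⟨fun j => MulOpposite.op (MulOpposite.op (w j)) • y, funext fun i => ?_⟩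
      have h5 : colMap U w i = ∑ j, FreeCat.mat U i j * w j := rfl
      rw [h5]
      change ∑ j, MulOpposite.op (MulOpposite.op (FreeCat.mat U i j)) •
        MulOpposite.op (MulOpposite.op (w j)) • y = _
      simp only [smul_smul, Finset.op_sum, Finset.sum_smul]
      rfl
    let b' : X.obj →+ N.obj →+ Q := p.toAddMonoidHom.liftOfSurjective hp ⟨b, hb⟩
    have hb' : ∀ c, b' (p c) = b c := fun c =>
      AddMonoidHom.liftOfRightInverse_comp_apply p.toAddMonoidHom _ _ ⟨b, hb⟩ c
    let Θ : Ten X N →+ Q := Ten.lift b' fun x a n => by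
      obtain ⟨c, rfl⟩ := hp x
      rw [← map_smul, hb', hb']
      refine congrArg QuotientAddGroup.mk (funext fun i => ?_)
      rw [smul_smul]
      rfl
    have h1 : Θ (ev π h) = QuotientAddGroup.mk fun i => FPMod.lin h (Pi.single i 1) := by
      rw [hπ, map_sum]
      have h2 : ∀ i, Θ (Ten.tmul (e i) (FPMod.lin h (Pi.single i 1))) =
          QuotientAddGroup.mk (Pi.single i (FPMod.lin h (Pi.single i 1))) := fun i => by
        rw [Ten.lift_tmul, hb']
        refine congrArg QuotientAddGroup.mk (funext fun i' => ?_)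
        by_cases hi : i' = i
        · subst hi
          rw [Pi.single_eq_same, Pi.single_eq_same, MulOpposite.op_one, MulOpposite.op_one,
            one_smul]
        · rw [Pi.single_eq_of_ne hi, Pi.single_eq_of_ne hi, MulOpposite.op_zero,
            MulOpposite.op_zero, zero_smul]
      rw [Finset.sum_congr rfl fun i _ => h2 i]
      refine (map_sum (QuotientAddGroup.mk' u.range) _ _).symm.trans (congrArg _ ?_)
      exact Finset.univ_sum_single _
    obtain ⟨y, hy⟩ := (QuotientAddGroup.eq_zero_iff _).1
      (h1.symm.trans ((congrArg Θ h0).trans (map_zero Θ)))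
    refine ⟨FPMod.ofHom (ofVec y), FPMod.hom_ext ?_⟩
    refine Eq.trans ?_ (ofVec_self (FPMod.lin h))
    refine Eq.trans (ofVec_self _).symm (congrArg ofVec (funext fun i => ?_))
    refine Eq.trans ?_ (congrFun hy i)
    change ∑ j, MulOpposite.op (colMap (FreeCat.dual U) (Pi.single i 1) j) • y j =
      ∑ j, MulOpposite.op (MulOpposite.op (FreeCat.mat U i j)) • y j
    simp only [hf]
  · rintro ⟨g, rfl⟩
    have h3 : ∀ i, FPMod.lin (f ≫ g) (Pi.single i 1) =
        ∑ j, MulOpposite.op (MulOpposite.op (FreeCat.mat U i j)) •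
          FPMod.lin g (Pi.single j 1) := fun i => by
      change FPMod.lin g (colMap (FreeCat.dual U) (Pi.single i 1)) = _
      conv_lhs => rw [← ofVec_self (FPMod.lin g)]
      change ∑ j, MulOpposite.op (colMap (FreeCat.dual U) (Pi.single i 1) j) • _ = _
      simp only [hf]
    rw [hπ]
    simp only [h3, Ten.tmul_sum, ← Ten.smul_tmul]
    rw [Finset.sum_comm]
    refine Finset.sum_eq_zero fun j _ => ?_
    rw [← Ten.sum_tmul]
    have h4 : ∑ i, MulOpposite.op (FreeCat.mat U i j) • e i = 0 := by
      simp only [← hUj]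
      rw [← hpe]
      exact LinearMap.mem_ker.1 (hU ▸ LinearMap.mem_range_self _ _)
    rw [h4, Ten.zero_tmul]
    rfl
  · obtain ⟨x, rfl⟩ := Submodule.Quotient.mk_surjective _ x
    induction x with
    | zero => exact ⟨0, map_zero (π.app N).hom⟩
    | add x y hx hy =>
      obtain ⟨g, hg⟩ := hx
      obtain ⟨g', hg'⟩ := hy
      exact ⟨g + g', by rw [ev_add, hg, hg']; rfl⟩
    | tmul x n =>
      obtain ⟨c, rfl⟩ := hp x
      refine ⟨FPMod.ofHom (ofVec fun i => MulOpposite.op (MulOpposite.op (c i)) • n), ?_⟩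
      rw [hπ]
      change ∑ i, Ten.tmul (e i) (ofVec _ _) = Ten.tmul (p c) n
      simp only [ofVec_single]
      rw [hpe, Ten.sum_tmul]
      simp only [Ten.smul_tmul]

/-- Pushouts of finitely presented modules. -/
theorem FPMod.exists_pushout {W X Y : FPMod A} (a : W ⟶ X) (b : W ⟶ Y) :
    ∃ (Z : FPMod A) (i : X ⟶ Z) (j : Y ⟶ Z),
      a ≫ i = b ≫ j ∧ ∀ {M : FPMod A} (g : X ⟶ M) (h : Y ⟶ M), a ≫ g = b ≫ h →
        ∃ z : Z ⟶ M, i ≫ z = g ∧ j ≫ z = h := by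
  let K := LinearMap.range ((FPMod.lin a).prod (-FPMod.lin b))
  have : Module.FinitePresentation Aᵐᵒᵖ ((X.obj × Y.obj) ⧸ K) :=
    Module.finitePresentation_of_surjective K.mkQ (Submodule.mkQ_surjective _)
      (by rw [Submodule.ker_mkQ]; exact Submodule.fg_range _)
  refine ⟨FPMod.of ((X.obj × Y.obj) ⧸ K), FPMod.ofHom (K.mkQ ∘ₗ LinearMap.inl _ _ _),
    FPMod.ofHom (K.mkQ ∘ₗ LinearMap.inr _ _ _), FPMod.hom_ext' fun w => ?_, fun g h hgh => ?_⟩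
  · refine (Submodule.Quotient.eq K).2 ⟨w, ?_⟩
    ext <;> simp <;> rfl
  · refine ⟨FPMod.ofHom (K.liftQ ((FPMod.lin g).coprod (FPMod.lin h)) ?_),
      FPMod.hom_ext' fun x => ?_, FPMod.hom_ext' fun y => ?_⟩
    · rintro _ ⟨w, rfl⟩
      have h1 : FPMod.lin g (FPMod.lin a w) = FPMod.lin h (FPMod.lin b w) :=
        congr(FPMod.lin $hgh w)
      simp [h1]
    · change FPMod.lin g x + FPMod.lin h 0 = _
      rw [map_zero, add_zero]
    · change FPMod.lin g 0 + FPMod.lin h y = _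
      rw [map_zero, zero_add]

/-- The functor `Ker(X ⊗_A - ⟶ Y ⊗_A -)` for a morphism `f : X ⟶ Y` of `mod-A`. The kernel is
computed in the category of all functors; as it is finitely presented, it is also the kernel in
the full subcategory of finitely presented functors. -/
abbrev kerTensor {X Y : FPMod A} (f : X ⟶ Y) : FPFun Aᵐᵒᵖ :=
  ⟨kernel ((tensorFunctor A).map f), kernel_isFinitelyPresentedFunctor FPMod.exists_pushout
    (tensor_isFinitelyPresentedFunctor X) (tensor_isFinitelyPresentedFunctor Y) _⟩

/-- The morphism `Ker(f ⊗_A -) ⟶ Ker(f' ⊗_A -)` given by a commutative square, through the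
universal property of the kernel. -/
def kerTensorMap {X Y X' Y' : FPMod A} (f : X ⟶ Y) (f' : X' ⟶ Y') (φ : X ⟶ X') (ψ : Y ⟶ Y')
    (h : f ≫ ψ = φ ≫ f') : kerTensor f ⟶ kerTensor f' :=
  ObjectProperty.homMk (kernel.map _ _ ((tensorFunctor A).map φ) ((tensorFunctor A).map ψ)
    (by rw [← Functor.map_comp, ← Functor.map_comp, h]))

theorem kerTensorMap_ι {X Y X' Y' : FPMod A} (f : X ⟶ Y) (f' : X' ⟶ Y') (φ : X ⟶ X')
    (ψ : Y ⟶ Y') (h : f ≫ ψ = φ ≫ f') :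
    (kerTensorMap f f' φ ψ h).hom ≫ kernel.ι ((tensorFunctor A).map f') =
      kernel.ι ((tensorFunctor A).map f) ≫ (tensorFunctor A).map φ :=
  kernel.lift_ι _ _ _

theorem kerTensor_hom_ext {X Y : FPMod A} {f : X ⟶ Y} {F : FPFun Aᵐᵒᵖ} {a b : F ⟶ kerTensor f}
    (h : a.hom ≫ kernel.ι ((tensorFunctor A).map f) =
      b.hom ≫ kernel.ι ((tensorFunctor A).map f)) : a = b :=
  ObjectProperty.hom_ext _ (equalizer.hom_ext h)

/-- A fixed projective presentation of a finitely presented functor. -/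
def pres (F : FPFun A) : ProjPres F.obj := F.property.nonempty_projPres.some

/-- The action on objects of the Auslander–Gruson–Jensen duality:
if `Hom(Y, -) ⟶ Hom(X, -) ⟶ F ⟶ 0` is the presentation of `F` induced by `f : X ⟶ Y`,
then `dF = Ker(X ⊗_A - ⟶ Y ⊗_A -)`. -/
abbrev dObj (F : FPFun A) : FPFun Aᵐᵒᵖ := kerTensor (pres F).f

/-- A lift `Hom(φ, -)` of `α : F ⟶ G` to the presentations. -/
def liftφ {F G : FPFun A} (α : F ⟶ G) : (pres G).X ⟶ (pres F).X :=
  ((pres F).exists_lift (pres G) α.hom).choose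

theorem liftφ_spec {F G : FPFun A} (α : F ⟶ G) :
    homFunctorMap (liftφ α) ≫ (pres G).π = (pres F).π ≫ α.hom :=
  ((pres F).exists_lift (pres G) α.hom).choose_spec

/-- The second component of the lift of `α : F ⟶ G` to the presentations. -/
def liftψ {F G : FPFun A} (α : F ⟶ G) : (pres G).Y ⟶ (pres F).Y :=
  ((pres F).exists_lift' (pres G) (liftφ_spec α)).choose

theorem liftψ_spec {F G : FPFun A} (α : F ⟶ G) :
    (pres G).f ≫ liftψ α = liftφ α ≫ (pres F).f :=
  ((pres F).exists_lift' (pres G) (liftφ_spec α)).choose_spec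

/-- The action on morphisms of the Auslander–Gruson–Jensen duality: `α` is lifted to the
presentations, and the lift induces a morphism of the kernels. -/
def dMap {F G : FPFun A} (α : F ⟶ G) : dObj G ⟶ dObj F :=
  kerTensorMap _ _ (liftφ α) (liftψ α) (liftψ_spec α)

/-- `dMap` does not depend on the lift. -/
theorem dMap_ι {F G : FPFun A} (α : F ⟶ G) (φ : (pres G).X ⟶ (pres F).X)
    (hφ : homFunctorMap φ ≫ (pres G).π = (pres F).π ≫ α.hom) :
    (dMap α).hom ≫ kernel.ι ((tensorFunctor A).map (pres F).f) =
      kernel.ι ((tensorFunctor A).map (pres G).f) ≫ (tensorFunctor A).map φ := by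
  refine (kerTensorMap_ι _ _ _ _ _).trans ?_
  obtain ⟨s, hs⟩ := (pres F).lift_unique (pres G) ((liftφ_spec α).trans hφ.symm)
  rw [← sub_eq_zero, ← Preadditive.comp_sub, ← Functor.map_sub, ← hs, Functor.map_comp,
    kernel.condition_assoc, zero_comp]

/-- The Auslander–Gruson–Jensen duality `d`, a contravariant functor from `mod-(mod-A)` to
`mod-(mod-Aᵒᵖ)`. -/
def d (A : Type u) [Ring A] : (FPFun A)ᵒᵖ ⥤ FPFun Aᵐᵒᵖ where
  obj F := dObj F.unop
  map α := dMap α.unop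
  map_id F := kerTensor_hom_ext (by
    refine (dMap_ι _ (𝟙 _) ?_).trans ?_
    · exact (congrArg (· ≫ _) (preadditiveCoyoneda.map_id _)).trans
        ((Category.id_comp _).trans (Category.comp_id _).symm)
    · exact (congrArg (_ ≫ ·) ((tensorFunctor A).map_id _)).trans
        ((Category.comp_id _).trans (Category.id_comp _).symm))
  map_comp {F G H} α β := kerTensor_hom_ext (by
    refine (dMap_ι _ (liftφ α.unop ≫ liftφ β.unop) ?_).trans ?_
    · change _ = _ ≫ β.unop.hom ≫ α.unop.hom
      rw [homFunctorMap_comp, Category.assoc, liftφ_spec, ← Category.assoc, liftφ_spec,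
        Category.assoc]
    · change _ = ((dMap α.unop).hom ≫ (dMap β.unop).hom) ≫ _
      refine Eq.trans ?_ (Category.assoc _ _ _).symm
      refine Eq.trans ?_ (congrArg (_ ≫ ·) (dMap_ι β.unop _ (liftφ_spec _))).symm
      refine Eq.trans ?_ (Category.assoc _ _ _)
      refine Eq.trans ?_ (congrArg (· ≫ _) (dMap_ι α.unop _ (liftφ_spec _))).symm
      rw [Functor.map_comp, Category.assoc])

end Tensor

end AGJ

end

/-! Both functors `k` are quasi-inverse to functors given by an explicit formula, so it is enough to
prove that `dIII` and `d` correspond under `kInv`. The rest is formal cancellation.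

Let a chain be given by matrices `u` (n × m) and `v` (p × n), and let `N` be a left `A`-module. The
functor of the chain has the presentation induced by `Coker u ⟶ Coker vu`, so its dual sends `N` to
the kernel of `Nⁿ/uNᵐ → Nᵖ/vuNᵐ`. An element `q` of `Nⁿ` represents a class of this kernel iff `vq ∈
vuNᵐ`, that is, iff `q ∈ Ker v + uNᵐ`. Hence the kernel is `Ker v / (Ker v ∩ uNᵐ)`. On the other
side, `Hom(Coker vᵗ, N)` is `Ker v` inside `Nⁿ`, and `Hom(Coker uᵗvᵗ, N)` is `Ker vu` inside `Nᵐ`.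
The map between them is multiplication by `u`, with image `Ker v ∩ uNᵐ`. So the functor of the dual
chain is the same quotient.

The identification is carried by `pairing`, the element `∑ p(eᵢ) ⊗ q(eᵢ)`. By `pairing_colMap` a
matrix crosses the pairing by becoming its dual. `exists_pairing_eq` and
`exists_factor_of_pairing_eq_zero` together say that `Coker u ⊗ N` is `Nⁿ/uNᵐ`. These give
`kerTensorPres`.

It remains to pass from the tautological presentation of the functor to the chosen one used by `d`,
and to prove naturality. Both rest on one fact: two lifts of the same transformation differ by a map
through the presentation morphism, and such a map vanishes on the kernel of the tensored morphism.
-/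

noncomputable section

namespace AGJ

/-! ### Pairing of homomorphisms from free modules, and tensor products with cokernels of matrices.
-/

section Pairing

variable {A : Type u} [Ring A]

/-- The element `∑ p(eᵢ) ⊗ q(eᵢ)` of `M ⊗_A N` given by homomorphisms out of free modules of the
same rank. -/
def pairing {n : ℕ} {M : FPMod A} {N : FPMod Aᵐᵒᵖ} (p : (Fin n → A) →ₗ[Aᵐᵒᵖ] M.obj)
    (q : (Fin n → Aᵐᵒᵖ) →ₗ[Aᵐᵒᵖᵐᵒᵖ] N.obj) : Ten M N :=
  ∑ i, Ten.tmul (p (Pi.single i 1)) (q (Pi.single i 1))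

theorem colMap_single {X Y : FreeCat A} (U : X ⟶ Y) (j : Fin X.n) (i : Fin Y.n) :
    colMap U (Pi.single j 1) i = FreeCat.mat U i j :=
  congrFun (Matrix.mulVec_single_one (FreeCat.mat U) j) i

theorem colMap_dual_single {X Y : FreeCat A} (U : X ⟶ Y) (i : Fin Y.n) (j : Fin X.n) :
    colMap (FreeCat.dual U) (Pi.single i 1) j = MulOpposite.op (FreeCat.mat U i j) :=
  congrFun (Matrix.mulVec_single_one (FreeCat.mat (FreeCat.dual U)) i) j

/-- A homomorphism out of a free right module is determined by the images of the basis. -/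
theorem apply_eq_sum_single {n : ℕ} {M : FPMod A} (p : (Fin n → A) →ₗ[Aᵐᵒᵖ] M.obj)
    (c : Fin n → A) : p c = ∑ i, MulOpposite.op (c i) • p (Pi.single i 1) := by
  have hc : c = ∑ j, MulOpposite.op (c j) • (Pi.single j 1 : Fin n → A) := by
    ext i
    simp [Finset.sum_apply, Pi.single_apply]
  conv_lhs => rw [hc, map_sum]
  simp only [map_smul]

/-- A matrix over `A` may be moved across the pairing by passing to its dual. -/
theorem pairing_colMap {X Y : FreeCat A} (U : X ⟶ Y) {M : FPMod A} {N : FPMod Aᵐᵒᵖ}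
    (p : (Fin Y.n → A) →ₗ[Aᵐᵒᵖ] M.obj) (q : (Fin X.n → Aᵐᵒᵖ) →ₗ[Aᵐᵒᵖᵐᵒᵖ] N.obj) :
    pairing (p ∘ₗ colMap U) q = pairing p (q ∘ₗ colMap (FreeCat.dual U)) := by
  have h1 : ∀ j, (p ∘ₗ colMap U) (Pi.single j 1) =
      ∑ i, MulOpposite.op (FreeCat.mat U i j) • p (Pi.single i 1) := fun j => by
    rw [LinearMap.comp_apply, apply_eq_sum_single]
    simp only [colMap_single]
  have h2 : ∀ i, (q ∘ₗ colMap (FreeCat.dual U)) (Pi.single i 1) =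
      ∑ j, MulOpposite.op (MulOpposite.op (FreeCat.mat U i j)) • q (Pi.single j 1) := fun i => by
    rw [LinearMap.comp_apply, apply_eq_sum_single]
    exact Finset.sum_congr rfl fun j _ => by rw [← colMap_dual_single U i j]
  -- Both sides become the double sum of `p(eᵢ) ⊗ uᵢⱼ q(eⱼ)`, with opposite orders of summation.
  simp only [pairing, h1, h2, Ten.sum_tmul, Ten.tmul_sum, Ten.smul_tmul]
  exact Finset.sum_comm

theorem pairing_add {n : ℕ} {M : FPMod A} {N : FPMod Aᵐᵒᵖ} (p : (Fin n → A) →ₗ[Aᵐᵒᵖ] M.obj)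
    (q q' : (Fin n → Aᵐᵒᵖ) →ₗ[Aᵐᵒᵖᵐᵒᵖ] N.obj) :
    pairing p (q + q') = pairing p q + pairing p q' := by
  simp only [pairing, LinearMap.add_apply, Ten.tmul_add, Finset.sum_add_distrib]

theorem pairing_zero_left {n : ℕ} {M : FPMod A} {N : FPMod Aᵐᵒᵖ}
    (q : (Fin n → Aᵐᵒᵖ) →ₗ[Aᵐᵒᵖᵐᵒᵖ] N.obj) :
    pairing (0 : (Fin n → A) →ₗ[Aᵐᵒᵖ] M.obj) q = 0 :=
  Finset.sum_eq_zero fun _ _ => Ten.zero_tmul _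

theorem pairing_zero_right {n : ℕ} {M : FPMod A} {N : FPMod Aᵐᵒᵖ}
    (p : (Fin n → A) →ₗ[Aᵐᵒᵖ] M.obj) :
    pairing p (0 : (Fin n → Aᵐᵒᵖ) →ₗ[Aᵐᵒᵖᵐᵒᵖ] N.obj) = 0 := by
  simpa using pairing_add p (0 : (Fin n → Aᵐᵒᵖ) →ₗ[Aᵐᵒᵖᵐᵒᵖ] N.obj) 0

theorem map_pairing {n : ℕ} {M M' : FPMod A} {N N' : FPMod Aᵐᵒᵖ} (f : M ⟶ M') (g : N ⟶ N')
    (p : (Fin n → A) →ₗ[Aᵐᵒᵖ] M.obj) (q : (Fin n → Aᵐᵒᵖ) →ₗ[Aᵐᵒᵖᵐᵒᵖ] N.obj) :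
    Ten.map f g (pairing p q) = pairing (FPMod.lin f ∘ₗ p) (FPMod.lin g ∘ₗ q) :=
  map_sum (Ten.map f g) _ _

/-- If `p` is surjective, every element of `M ⊗_A N` is a pairing with `p`. -/
theorem exists_pairing_eq {n : ℕ} {M : FPMod A} {N : FPMod Aᵐᵒᵖ}
    (p : (Fin n → A) →ₗ[Aᵐᵒᵖ] M.obj) (hp : Function.Surjective p) (t : Ten M N) :
    ∃ q : (Fin n → Aᵐᵒᵖ) →ₗ[Aᵐᵒᵖᵐᵒᵖ] N.obj, pairing p q = t := by
  obtain ⟨t, rfl⟩ := Submodule.Quotient.mk_surjective _ t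
  induction t with
  | zero => exact ⟨0, pairing_zero_right p⟩
  | add x y hx hy =>
    obtain ⟨g, hg⟩ := hx
    obtain ⟨g', hg'⟩ := hy
    exact ⟨g + g', by rw [pairing_add, hg, hg']; rfl⟩
  | tmul x y =>
    obtain ⟨c, rfl⟩ := hp x
    -- `p(c) ⊗ y = ∑ p(eᵢ)cᵢ ⊗ y = ∑ p(eᵢ) ⊗ cᵢy`, so `eᵢ ↦ cᵢy` works. Left `A`-modules are modules
    -- over `Aᵐᵒᵖᵐᵒᵖ`, whence the double `op`.
    refine ⟨ofVec fun i => MulOpposite.op (MulOpposite.op (c i)) • y, ?_⟩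
    change _ = Ten.tmul (p c) y
    simp only [pairing, ofVec_single]
    rw [apply_eq_sum_single, Ten.sum_tmul]
    simp only [Ten.smul_tmul]

/-- Right exactness of the tensor product, for a module given by a matrix `U`: a pairing with the
projection onto `Coker U` vanishes only if the second argument factors through the dual of `U`. -/
theorem exists_factor_of_pairing_eq_zero {X Y : FreeCat A} (U : X ⟶ Y) {N : FPMod Aᵐᵒᵖ}
    (q : (Fin Y.n → Aᵐᵒᵖ) →ₗ[Aᵐᵒᵖᵐᵒᵖ] N.obj) (hq : pairing (coker.proj U) q = 0) :
    ∃ z : (Fin X.n → Aᵐᵒᵖ) →ₗ[Aᵐᵒᵖᵐᵒᵖ] N.obj, z ∘ₗ colMap (FreeCat.dual U) = q := by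
  -- `u` is multiplication by `U` on column vectors over `N`. The plan is to build a map from `Coker
  -- U ⊗ N` to its cokernel `Q` that recovers the class of the vector `(q(eᵢ))`. This map need not
  -- be shown to be bijective.
  let u : (Fin X.n → N.obj) →+ (Fin Y.n → N.obj) := AddMonoidHom.mk'
    (fun y i => ∑ j, MulOpposite.op (MulOpposite.op (FreeCat.mat U i j)) • y j)
    fun y y' => funext fun i => by simp [Finset.sum_add_distrib]
  let Q := (Fin Y.n → N.obj) ⧸ u.range
  let b : (Fin Y.n → A) →+ N.obj →+ Q := AddMonoidHom.mk'
    (fun c => AddMonoidHom.mk'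
      (fun y => QuotientAddGroup.mk fun i => MulOpposite.op (MulOpposite.op (c i)) • y)
      fun y y' => by
        rw [← QuotientAddGroup.mk_add]
        exact congrArg _ (funext fun i => smul_add _ _ _))
    fun c c' => AddMonoidHom.ext fun y => congrArg QuotientAddGroup.mk
      (funext fun i => add_smul (MulOpposite.op (MulOpposite.op (c i)))
        (MulOpposite.op (MulOpposite.op (c' i))) y)
  -- If `c = Uw`, then the vector `(cᵢy)` is `U` applied to `(wⱼy)`, hence zero in `Q`. So `b`
  -- descends to `Coker U` in its first argument.
  have hb : (coker.proj U).toAddMonoidHom.ker ≤ b.ker := fun c hc => by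
    obtain ⟨w, rfl⟩ := (coker.proj_eq_zero U c).1 hc
    refine AddMonoidHom.ext fun y => (QuotientAddGroup.eq_zero_iff _).2
      ⟨fun j => MulOpposite.op (MulOpposite.op (w j)) • y, funext fun i => ?_⟩
    have hw : colMap U w i = ∑ j, FreeCat.mat U i j * w j := rfl
    rw [hw]
    change ∑ j, MulOpposite.op (MulOpposite.op (FreeCat.mat U i j)) •
      MulOpposite.op (MulOpposite.op (w j)) • y = _
    simp only [smul_smul, Finset.op_sum, Finset.sum_smul]
    rfl
  let b' : (coker U).obj →+ N.obj →+ Q :=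
    (coker.proj U).toAddMonoidHom.liftOfSurjective (coker.proj_surjective U) ⟨b, hb⟩
  have hb' : ∀ c, b' (coker.proj U c) = b c := fun c =>
    AddMonoidHom.liftOfRightInverse_comp_apply (coker.proj U).toAddMonoidHom _ _ ⟨b, hb⟩ c
  let Θ : Ten (coker U) N →+ Q := Ten.lift b' fun x a n => by
    obtain ⟨c, rfl⟩ := coker.proj_surjective U x
    rw [← map_smul, hb', hb']
    refine congrArg QuotientAddGroup.mk (funext fun i => ?_)
    rw [smul_smul]
    rfl
  have hΘ : Θ (pairing (coker.proj U) q) = QuotientAddGroup.mk fun i => q (Pi.single i 1) := by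
    have h2 : ∀ i, Θ (Ten.tmul (coker.proj U (Pi.single i 1)) (q (Pi.single i 1))) =
        QuotientAddGroup.mk (Pi.single i (q (Pi.single i 1))) := fun i => by
      rw [Ten.lift_tmul, hb']
      refine congrArg QuotientAddGroup.mk (funext fun i' => ?_)
      by_cases hi : i' = i
      · subst hi
        rw [Pi.single_eq_same, Pi.single_eq_same, MulOpposite.op_one, MulOpposite.op_one,
          one_smul]
      · rw [Pi.single_eq_of_ne hi, Pi.single_eq_of_ne hi, MulOpposite.op_zero,
          MulOpposite.op_zero, zero_smul]
    rw [pairing, map_sum, Finset.sum_congr rfl fun i _ => h2 i]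
    refine (map_sum (QuotientAddGroup.mk' u.range) _ _).symm.trans (congrArg _ ?_)
    exact Finset.univ_sum_single _
  -- Vanishing in `Q` yields `y` with `Uy = (q(eᵢ))`. The homomorphism with values `yⱼ` on the basis
  -- is the required factor.
  obtain ⟨y, hy⟩ := (QuotientAddGroup.eq_zero_iff _).1
    (hΘ.symm.trans ((congrArg Θ hq).trans (map_zero Θ)))
  refine ⟨ofVec y, ?_⟩
  refine (ofVec_self _).symm.trans (Eq.trans (congrArg ofVec (funext fun i => ?_)) (ofVec_self q))
  refine Eq.trans ?_ (congrFun hy i)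
  change ∑ j, MulOpposite.op (colMap (FreeCat.dual U) (Pi.single i 1) j) • y j =
    ∑ j, MulOpposite.op (MulOpposite.op (FreeCat.mat U i j)) • y j
  exact Finset.sum_congr rfl fun j _ => by rw [← colMap_dual_single U i j]

theorem coker.proj_comp_colMap {X Y : FreeCat A} (U : X ⟶ Y) : coker.proj U ∘ₗ colMap U = 0 :=
  LinearMap.ext fun x => (coker.proj_eq_zero U _).2 ⟨x, rfl⟩

/-- The morphism out of `Coker U` induced by a homomorphism that vanishes on the image of `U`. -/
def coker.desc {X Y : FreeCat A} (U : X ⟶ Y) {M : FPMod A} (p : (Fin Y.n → A) →ₗ[Aᵐᵒᵖ] M.obj)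
    (hp : p ∘ₗ colMap U = 0) : coker U ⟶ M :=
  FPMod.ofHom ((LinearMap.range (colMap U)).liftQ p (by
    rintro _ ⟨y, rfl⟩
    exact LinearMap.congr_fun hp y))

end Pairing

/-! ### Independence of the dual from the projective presentation. -/

section Comparison

variable {A : Type u} [Ring A]

/-- Tensoring is additive, so the difference of the two sides factors through `f ⊗ -` preceded by
the inclusion of its kernel, which is zero. -/
theorem kernel_ι_map_eq {X Y Z : FPMod A} (f : X ⟶ Y) {φ φ' : X ⟶ Z} (s : Y ⟶ Z)
    (hs : f ≫ s = φ - φ') :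
    kernel.ι ((tensorFunctor A).map f) ≫ (tensorFunctor A).map φ =
      kernel.ι ((tensorFunctor A).map f) ≫ (tensorFunctor A).map φ' := by
  rw [← sub_eq_zero, ← Preadditive.comp_sub, ← Functor.map_sub, ← hs, Functor.map_comp,
    kernel.condition_assoc, zero_comp]

/-- A map into the kernel is determined after the inclusion, where only `φ` and `φ'` are visible. No
homotopy relating `ψ` and `ψ'` to the identity is therefore needed. -/
theorem kerTensorMap_comp_eq_id {X Y X' Y' : FPMod A} (f : X ⟶ Y) (f' : X' ⟶ Y') (φ : X ⟶ X')
    (ψ : Y ⟶ Y') (h : f ≫ ψ = φ ≫ f') (φ' : X' ⟶ X) (ψ' : Y' ⟶ Y) (h' : f' ≫ ψ' = φ' ≫ f)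
    (s : Y ⟶ X) (hs : f ≫ s = φ ≫ φ' - 𝟙 X) :
    kerTensorMap f f' φ ψ h ≫ kerTensorMap f' f φ' ψ' h' = 𝟙 _ := by
  refine kerTensor_hom_ext ?_
  refine (Category.assoc _ _ _).trans ?_
  refine (congrArg (_ ≫ ·) (kerTensorMap_ι f' f φ' ψ' h')).trans ?_
  refine (Category.assoc _ _ _).symm.trans ?_
  refine (congrArg (· ≫ _) (kerTensorMap_ι f f' φ ψ h)).trans ?_
  rw [Category.assoc, ← Functor.map_comp, kernel_ι_map_eq f s hs,
    CategoryTheory.Functor.map_id]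
  exact (Category.comp_id _).trans (Category.id_comp _).symm

/-- Two lifts of the identity in opposite directions are mutually inverse up to a morphism through
the presentation. -/
theorem ProjPres.exists_homotopy {C : Type u} [Category.{v} C] [Preadditive C]
    {F : C ⥤ AddCommGrpCat.{v}} (P Q : ProjPres F)
    {φ : P.X ⟶ Q.X} {φ' : Q.X ⟶ P.X} (h : homFunctorMap φ ≫ P.π = Q.π)
    (h' : homFunctorMap φ' ≫ Q.π = P.π) : ∃ s : P.Y ⟶ P.X, P.f ≫ s = φ ≫ φ' - 𝟙 _ := by
  refine P.lift_unique P ?_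
  rw [homFunctorMap_comp, Category.assoc, h, h', homFunctorMap, op_id,
    CategoryTheory.Functor.map_id, Category.id_comp]

/-- Representables are projective, so the identity of `F` lifts from the presentation `Q` to `P`. By
contravariance the underlying morphisms of `C` run from `P` to `Q`. -/
theorem ProjPres.exists_lift_id {C : Type u} [Category.{v} C] [Preadditive C]
    {F : C ⥤ AddCommGrpCat.{v}} (P Q : ProjPres F) :
    ∃ (φ : P.X ⟶ Q.X) (ψ : P.Y ⟶ Q.Y), homFunctorMap φ ≫ P.π = Q.π ∧ P.f ≫ ψ = φ ≫ Q.f := by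
  obtain ⟨φ, hφ⟩ := Q.exists_lift P (𝟙 F)
  obtain ⟨ψ, hψ⟩ := Q.exists_lift' P hφ
  exact ⟨φ, ψ, hφ.trans (Category.comp_id _), hψ⟩

/-- The dual of `F` may be computed by any projective presentation of `F`. -/
theorem exists_kerTensor_iso_dObj (F : FPFun A) (P : ProjPres F.obj) :
    ∃ (e : kerTensor P.f ≅ dObj F) (φ : P.X ⟶ (pres F).X),
      homFunctorMap φ ≫ P.π = (pres F).π ∧
      e.hom.hom ≫ kernel.ι ((tensorFunctor A).map (pres F).f) =
        kernel.ι ((tensorFunctor A).map P.f) ≫ (tensorFunctor A).map φ := by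
  -- Lifts of the identity in the two directions are inverse up to maps through the presentation
  -- morphisms, hence induce inverse maps of kernels. The lift `φ` is part of the conclusion because
  -- the naturality proof needs the formula for `e` in terms of it.
  obtain ⟨φ, ψ, h, hψ⟩ := P.exists_lift_id (pres F)
  obtain ⟨φ', ψ', h', hψ'⟩ := (pres F).exists_lift_id P
  obtain ⟨s, hs⟩ := P.exists_homotopy (pres F) h h'
  obtain ⟨t, ht⟩ := (pres F).exists_homotopy P h' h
  exact ⟨⟨kerTensorMap _ _ φ ψ hψ, kerTensorMap _ _ φ' ψ' hψ',
    kerTensorMap_comp_eq_id _ _ φ ψ hψ φ' ψ' hψ' s hs,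
    kerTensorMap_comp_eq_id _ _ φ' ψ' hψ' φ ψ hψ t ht⟩, φ, h, kerTensorMap_ι _ _ φ ψ hψ⟩

end Comparison

/-! ### The functor of the dual chain as the dual of the functor of the chain. -/

section DualChain

variable {A : Type u} [Ring A]

/-- The dual of a chain of matrices. -/
abbrev dualChain (X : Chain (FreeCat A)) : Chain (FreeCat Aᵐᵒᵖ) :=
  ⟨FreeCat.dual X.f₂, FreeCat.dual X.f₁⟩

/-- The dual of a morphism of chains. -/
def dualChainMap {X Y : Chain (FreeCat A)} (α : X ⟶ Y) : dualChain Y ⟶ dualChain X :=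
  (chainDual A).map α.op

/-- The natural transformation `Hom(Coker vᵗ, -) ⟶ Coker u ⊗_A -` for a chain given by `u` and
`v`. -/
def chainPairing (X : Chain (FreeCat A)) :
    homFunctor (coker (FreeCat.dual X.f₂)) ⟶ (tensorFunctor A).obj (coker X.f₁) where
  app N := AddCommGrpCat.ofHom (AddMonoidHom.mk'
    (fun h : coker (FreeCat.dual X.f₂) ⟶ N =>
      pairing (coker.proj X.f₁) (FPMod.lin h ∘ₗ coker.proj (FreeCat.dual X.f₂)))
    fun h h' => pairing_add (coker.proj X.f₁)
      (FPMod.lin h ∘ₗ coker.proj (FreeCat.dual X.f₂))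
      (FPMod.lin h' ∘ₗ coker.proj (FreeCat.dual X.f₂)))
  naturality N N' g := by
    refine AddCommGrpCat.hom_ext (AddMonoidHom.ext fun h => ?_)
    exact (map_pairing (𝟙 _) g (coker.proj X.f₁)
      (FPMod.lin (show coker (FreeCat.dual X.f₂) ⟶ N from h) ∘ₗ
        coker.proj (FreeCat.dual X.f₂))).symm

theorem ev_chainPairing (X : Chain (FreeCat A)) {N : FPMod Aᵐᵒᵖ}
    (h : coker (FreeCat.dual X.f₂) ⟶ N) :
    ev (chainPairing X) h =
      pairing (coker.proj X.f₁) (FPMod.lin h ∘ₗ coker.proj (FreeCat.dual X.f₂)) := rfl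

theorem ev_chainPairing_map (X : Chain (FreeCat A)) {M : FPMod A} (f : coker X.f₁ ⟶ M)
    {N : FPMod Aᵐᵒᵖ} (h : coker (FreeCat.dual X.f₂) ⟶ N) :
    ev (chainPairing X ≫ (tensorFunctor A).map f) h =
      pairing (FPMod.lin f ∘ₗ coker.proj X.f₁)
        (FPMod.lin h ∘ₗ coker.proj (FreeCat.dual X.f₂)) :=
  map_pairing f (𝟙 N) _ _

/-- By Yoneda only the identity of `Coker vᵗ` has to be tested. There `v` crosses the pairing as
`vᵗ`, which the projection onto `Coker vᵗ` kills. -/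
theorem chainPairing_chainMor (X : Chain (FreeCat A)) :
    chainPairing X ≫ (tensorFunctor A).map (chainMor X) = 0 := by
  refine ev_ext ((ev_chainPairing_map X _ _).trans ?_)
  refine (pairing_colMap X.f₂ (coker.proj (X.f₁ ≫ X.f₂)) _).trans ?_
  rw [LinearMap.comp_assoc, coker.proj_comp_colMap, LinearMap.comp_zero]
  exact pairing_zero_right _

/-- Both induced maps on cokernels come from the middle component `α₂`. By Yoneda the claim reduces
to moving that matrix across the pairing. -/
theorem chainPairing_naturality {X Y : Chain (FreeCat A)} (α : X ⟶ Y) :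
    homFunctorMap (chainMap₁ (dualChainMap α)) ≫ chainPairing Y =
      chainPairing X ≫ (tensorFunctor A).map (chainMap₁ α) := by
  refine ev_ext (Eq.trans ?_ (ev_chainPairing_map X _ _).symm)
  exact (pairing_colMap α.α₂ (coker.proj Y.f₁) (coker.proj (FreeCat.dual X.f₂))).symm

/-- The natural transformation from `Hom(Coker vᵗ, -)` to `Ker(Coker u ⊗_A - ⟶ Coker vu ⊗_A -)`
for a chain given by `u` and `v`. -/
def chainKerPairing (X : Chain (FreeCat A)) :
    homFunctor (coker (FreeCat.dual X.f₂)) ⟶ kernel ((tensorFunctor A).map (chainMor X)) :=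
  kernel.lift _ (chainPairing X) (chainPairing_chainMor X)

theorem chainKerPairing_ι (X : Chain (FreeCat A)) :
    chainKerPairing X ≫ kernel.ι ((tensorFunctor A).map (chainMor X)) = chainPairing X :=
  kernel.lift_ι _ _ _

theorem ι_ev_chainKerPairing (X : Chain (FreeCat A)) {N : FPMod Aᵐᵒᵖ}
    (h : coker (FreeCat.dual X.f₂) ⟶ N) :
    (kernel.ι ((tensorFunctor A).map (chainMor X))).app N (ev (chainKerPairing X) h) =
      pairing (coker.proj X.f₁) (FPMod.lin h ∘ₗ coker.proj (FreeCat.dual X.f₂)) := by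
  rw [← ev_trans, chainKerPairing_ι, ev_chainPairing]

/-- This is the equality of `Ker v ∩ uNᵐ` with the image of `Ker vu` under `u`. Since the inclusion
of the kernel is injective, vanishing can be tested in `Coker u ⊗ N`. -/
theorem ev_chainKerPairing_eq_zero_iff (X : Chain (FreeCat A)) {N : FPMod Aᵐᵒᵖ}
    (h : coker (FreeCat.dual X.f₂) ⟶ N) :
    ev (chainKerPairing X) h = 0 ↔
      ∃ g : coker (FreeCat.dual X.f₂ ≫ FreeCat.dual X.f₁) ⟶ N, chainMor (dualChain X) ≫ g = h := by
  refine ((injective_iff_map_eq_zero' _).1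
    (kernel_app_injective ((tensorFunctor A).map (chainMor X)) N) _).symm.trans ?_
  refine (Eq.congr_left (ι_ev_chainKerPairing X h)).trans ?_
  constructor
  · intro h0
    obtain ⟨z, hz⟩ := exists_factor_of_pairing_eq_zero X.f₁ _ h0
    -- As `z ∘ uᵗ` equals `h` after the projection onto `Coker vᵗ`, it kills `vᵗ`. So `z` kills
    -- `uᵗvᵗ` and descends.
    refine ⟨coker.desc (FreeCat.dual X.f₂ ≫ FreeCat.dual X.f₁) z ?_, coker.hom_ext fun x => ?_⟩
    · rw [colMap_comp, ← LinearMap.comp_assoc, hz, LinearMap.comp_assoc,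
        coker.proj_comp_colMap, LinearMap.comp_zero]
    · exact LinearMap.congr_fun hz x
  · rintro ⟨g, rfl⟩
    have hg : FPMod.lin (chainMor (dualChain X) ≫ g) ∘ₗ coker.proj (FreeCat.dual X.f₂) =
        (FPMod.lin g ∘ₗ coker.proj (FreeCat.dual X.f₂ ≫ FreeCat.dual X.f₁)) ∘ₗ
          colMap (FreeCat.dual X.f₁) := LinearMap.ext fun x => rfl
    rw [hg, ← pairing_colMap, coker.proj_comp_colMap, pairing_zero_left]
    rfl

/-- This is the step from `vq ∈ vuNᵐ` to `q ∈ Ker v + uNᵐ`: if `vq = vuz`, replace `q` by `q - uz`,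
which represents the same class and is killed by `v`. -/
theorem exists_ev_chainKerPairing_eq (X : Chain (FreeCat A)) {N : FPMod Aᵐᵒᵖ}
    (x : (kernel ((tensorFunctor A).map (chainMor X))).obj N) :
    ∃ h : coker (FreeCat.dual X.f₂) ⟶ N, ev (chainKerPairing X) h = x := by
  obtain ⟨q, hq⟩ := exists_pairing_eq (coker.proj X.f₁) (coker.proj_surjective _)
    ((kernel.ι ((tensorFunctor A).map (chainMor X))).app N x)
  have h0 : Ten.map (chainMor X) (𝟙 N) (pairing (coker.proj X.f₁) q) = 0 := by
    rw [hq]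
    exact (kernel_app_exact ((tensorFunctor A).map (chainMor X)) N _).2 ⟨x, rfl⟩
  have h1 : pairing (coker.proj (X.f₁ ≫ X.f₂)) (q ∘ₗ colMap (FreeCat.dual X.f₂)) = 0 :=
    (pairing_colMap X.f₂ _ q).symm.trans ((map_pairing (chainMor X) (𝟙 N) _ q).symm.trans h0)
  obtain ⟨z, hz⟩ := exists_factor_of_pairing_eq_zero _ _ h1
  rw [FreeCat.dual_comp, colMap_comp, ← LinearMap.comp_assoc] at hz
  have h2 : (q - z ∘ₗ colMap (FreeCat.dual X.f₁)) ∘ₗ colMap (FreeCat.dual X.f₂) = 0 := by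
    rw [LinearMap.sub_comp, hz, sub_self]
  have h3 : pairing (coker.proj X.f₁) (z ∘ₗ colMap (FreeCat.dual X.f₁)) = 0 := by
    rw [← pairing_colMap, coker.proj_comp_colMap, pairing_zero_left]
  refine ⟨coker.desc (FreeCat.dual X.f₂) _ h2, kernel_app_injective _ N ?_⟩
  refine (ι_ev_chainKerPairing X _).trans (Eq.trans ?_ hq)
  have h4 := pairing_add (coker.proj X.f₁) (q - z ∘ₗ colMap (FreeCat.dual X.f₁))
    (z ∘ₗ colMap (FreeCat.dual X.f₁))
  rw [sub_add_cancel, h3, add_zero] at h4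
  exact h4.symm

/-- For a chain given by `u` and `v`, the functor `Ker(Coker u ⊗_A - ⟶ Coker vu ⊗_A -)` is
presented by the dual chain. -/
def kerTensorPres (X : Chain (FreeCat A)) :
    ProjPres (kernel ((tensorFunctor A).map (chainMor X))) where
  f := chainMor (dualChain X)
  π := chainKerPairing X
  exact _ h := ev_chainKerPairing_eq_zero_iff X h
  surj _ x := exists_ev_chainKerPairing_eq X x

theorem chainMor_dualChain_chainKerPairing (X : Chain (FreeCat A)) :
    homFunctorMap (chainMor (dualChain X)) ≫ chainKerPairing X = 0 :=
  (kerTensorPres X).f_π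

theorem isIso_desc_chainKerPairing (X : Chain (FreeCat A)) :
    IsIso (cokernel.desc (homFunctorMap (chainMor (dualChain X))) (chainKerPairing X)
      (chainMor_dualChain_chainKerPairing X)) :=
  (kerTensorPres X).isIso_desc

/-- The functor attached to the dual of a chain given by `u` and `v` is
`Ker(Coker u ⊗_A - ⟶ Coker vu ⊗_A -)`. -/
def chainFunDualIsoKerTensor (X : Chain (FreeCat A)) :
    chainFun (dualChain X) ≅ kerTensor (chainMor X) :=
  haveI := isIso_desc_chainKerPairing X
  ObjectProperty.isoMk _ (asIso (cokernel.desc (homFunctorMap (chainMor (dualChain X)))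
    (chainKerPairing X) (chainMor_dualChain_chainKerPairing X)))

theorem π_chainFunDualIsoKerTensor (X : Chain (FreeCat A)) :
    cokernel.π (homFunctorMap (chainMor (dualChain X))) ≫
      (chainFunDualIsoKerTensor X).hom.hom = chainKerPairing X :=
  cokernel.π_desc _ _ _

/-- The functor attached to the dual of a chain is the dual of the functor attached to the
chain. -/
theorem exists_chainFun_dual_iso (X : Chain (FreeCat A)) :
    ∃ (e : chainFun (dualChain X) ≅ dObj (chainFun X))
      (φ : coker X.f₁ ⟶ (pres (chainFun X)).X),
      homFunctorMap φ ≫ cokernel.π (homFunctorMap (chainMor X)) = (pres (chainFun X)).π ∧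
      cokernel.π (homFunctorMap (chainMor (dualChain X))) ≫ e.hom.hom ≫
          kernel.ι ((tensorFunctor A).map (pres (chainFun X)).f) =
        chainPairing X ≫ (tensorFunctor A).map φ := by
  -- The comparison is applied to the tautological presentation, with its fields spelled out as
  -- `chainMor X` and `cokernel.π`.
  obtain ⟨e, φ, hφ, he⟩ : ∃ (e : kerTensor (chainMor X) ≅ dObj (chainFun X))
      (φ : coker X.f₁ ⟶ (pres (chainFun X)).X),
      homFunctorMap φ ≫ cokernel.π (homFunctorMap (chainMor X)) = (pres (chainFun X)).π ∧
      e.hom.hom ≫ kernel.ι ((tensorFunctor A).map (pres (chainFun X)).f) =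
        kernel.ι ((tensorFunctor A).map (chainMor X)) ≫ (tensorFunctor A).map φ :=
    exists_kerTensor_iso_dObj (chainFun X) (cokerPres (chainMor X))
  refine ⟨chainFunDualIsoKerTensor X ≪≫ e, φ, hφ, ?_⟩
  have h1 : ((chainFunDualIsoKerTensor X) ≪≫ e).hom.hom =
    (chainFunDualIsoKerTensor X).hom.hom ≫ e.hom.hom := rfl
  rw [h1, Category.assoc, he, ← Category.assoc, π_chainFunDualIsoKerTensor, ← Category.assoc,
    chainKerPairing_ι]

/-- The isomorphism of `exists_chainFun_dual_iso`. -/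
def chainFunDualIso (X : Chain (FreeCat A)) : chainFun (dualChain X) ≅ dObj (chainFun X) :=
  (exists_chainFun_dual_iso X).choose

/-- The lift `φ` may stay unspecified, because by `chainPairing_map_eq` its choice is invisible
after `chainPairing X`. -/
theorem chainFunDualIso_spec (X : Chain (FreeCat A)) :
    ∃ φ : coker X.f₁ ⟶ (pres (chainFun X)).X,
      homFunctorMap φ ≫ cokernel.π (homFunctorMap (chainMor X)) = (pres (chainFun X)).π ∧
      cokernel.π (homFunctorMap (chainMor (dualChain X))) ≫ (chainFunDualIso X).hom.hom ≫
          kernel.ι ((tensorFunctor A).map (pres (chainFun X)).f) =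
        chainPairing X ≫ (tensorFunctor A).map φ :=
  (exists_chainFun_dual_iso X).choose_spec

/-- Postcomposing the pairing with two lifts of the same morphism gives the same result. -/
theorem chainPairing_map_eq (X : Chain (FreeCat A)) {Z : FPMod A} {φ φ' : coker X.f₁ ⟶ Z}
    (h : homFunctorMap φ ≫ cokernel.π (homFunctorMap (chainMor X)) =
      homFunctorMap φ' ≫ cokernel.π (homFunctorMap (chainMor X))) :
    chainPairing X ≫ (tensorFunctor A).map φ = chainPairing X ≫ (tensorFunctor A).map φ' := by
  obtain ⟨s, hs⟩ : ∃ s : coker (X.f₁ ≫ X.f₂) ⟶ Z, chainMor X ≫ s = φ - φ' :=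
    -- Uniqueness of lifts uses only the object `Z` of the first presentation, so any presentation
    -- starting at `Z` will do. This one presents the zero functor.
    (cokerPres (𝟙 Z)).lift_unique (cokerPres (chainMor X)) h
  rw [← chainKerPairing_ι, Category.assoc, Category.assoc, kernel_ι_map_eq _ s hs]

/-- Both sides go from a cokernel to a kernel, so they may be compared after the projection and the
inclusion. Each then becomes `chainPairing X` followed by tensoring with a morphism `Coker u ⟶ (pres
(chainFun Y)).X`. The two morphisms, `chainMap₁ α ≫ ψ` and `φ ≫ liftφ (chainFunMap α)`, both lift
`chainFunMap α`, hence agree after the pairing. -/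
theorem chainFunDualIso_naturality {X Y : Chain (FreeCat A)} (α : X ⟶ Y) :
    chainFunMap (dualChainMap α) ≫ (chainFunDualIso Y).hom =
      (chainFunDualIso X).hom ≫ dMap (chainFunMap α) := by
  obtain ⟨φ, hφ, hX⟩ := chainFunDualIso_spec X
  obtain ⟨ψ, hψ, hY⟩ := chainFunDualIso_spec Y
  have hθ := liftφ_spec (chainFunMap α)
  have hlift : homFunctorMap (chainMap₁ α ≫ ψ) ≫ cokernel.π (homFunctorMap (chainMor X)) =
      homFunctorMap (φ ≫ liftφ (chainFunMap α)) ≫ cokernel.π (homFunctorMap (chainMor X)) := by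
    rw [homFunctorMap_comp, homFunctorMap_comp, Category.assoc, Category.assoc, hφ, hθ,
      ← chainFunMap_π, ← Category.assoc, hψ]
  have hd := dMap_ι (chainFunMap α) _ hθ
  refine chainFun_hom_ext ((cancel_mono (kernel.ι ((tensorFunctor A).map
    (pres (chainFun Y)).f))).1 ?_)
  change (_ ≫ (chainFunMap (dualChainMap α)).hom ≫ (chainFunDualIso Y).hom.hom) ≫ _ =
    (_ ≫ (chainFunDualIso X).hom.hom ≫ (dMap (chainFunMap α)).hom) ≫ _
  trans chainPairing X ≫ (tensorFunctor A).map (chainMap₁ α ≫ ψ)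
  · rw [← Category.assoc (cokernel.π _), chainFunMap_π, Category.assoc, Category.assoc, hY,
      ← Category.assoc, chainPairing_naturality, Category.assoc, Functor.map_comp]
  · rw [chainPairing_map_eq X hlift, Category.assoc, Category.assoc, hd,
      ← Category.assoc (chainFunDualIso X).hom.hom, ← Category.assoc (cokernel.π _), hX,
      Functor.map_comp, Category.assoc]

end DualChain

/-! ### Passage to Adelman's category and to the quasi-inverses. -/

section Duality

variable {A : Type u} [Ring A]

/-- The comparison of functors takes values in an opposite category, where the component from the
dual chain to the dual functor is the opposite of the inverse. -/
theorem chainFunDualIso_inv_naturality {X Y : Chain (FreeCat A)} (α : X ⟶ Y) :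
    (chainFunDualIso X).inv ≫ chainFunMap (dualChainMap α) =
      dMap (chainFunMap α) ≫ (chainFunDualIso Y).inv := by
  rw [Iso.inv_comp_eq, ← Category.assoc, Iso.eq_comp_inv, chainFunDualIso_naturality]

/-- On the class of a chain morphism the functors are given by explicit maps. With these formulas
the naturality square in `dIIICompKInvIso` becomes `chainFunDualIso_inv_naturality`. -/
theorem dIII_comp_kInv_map {X Y : Chain (FreeCat A)} (α : X ⟶ Y) :
    (dIII A ⋙ kInv Aᵐᵒᵖ).map (Quiver.Hom.op ((CategoryTheory.Quotient.functor _).map α)) =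
      (chainFunMap (dualChainMap α)).op := rfl

theorem kInv_leftOp_map {X Y : Chain (FreeCat A)} (α : X ⟶ Y) :
    (kInv A).leftOp.map (Quiver.Hom.op ((CategoryTheory.Quotient.functor _).map α)) =
      chainFunMap α := rfl

theorem d_rightOp_map {F G : FPFun A} (β : F ⟶ G) : (d A).rightOp.map β = (dMap β).op := rfl

theorem kInv_leftOp_comp_d_rightOp_map {X Y : Chain (FreeCat A)} (α : X ⟶ Y) :
    ((kInv A).leftOp ⋙ (d A).rightOp).map
        (Quiver.Hom.op ((CategoryTheory.Quotient.functor _).map α)) =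
      (dMap (chainFunMap α)).op :=
  (congrArg (d A).rightOp.map (kInv_leftOp_map α)).trans (d_rightOp_map _)

variable (A)

/-- The two dualities correspond to each other under `kInv`. -/
def dIIICompKInvIso : dIII A ⋙ kInv Aᵐᵒᵖ ≅ (kInv A).leftOp ⋙ (d A).rightOp :=
  NatIso.ofComponents
    (fun X => (show op (chainFun (dualChain X.unop.as)) ≅ op (dObj (chainFun X.unop.as)) from
      (chainFunDualIso X.unop.as).symm.op)) (by
    intro X Y f
    -- Every morphism of Adelman's category is the class of a chain morphism, so naturality is
    -- checked on a representative.
    obtain ⟨α, hα⟩ := (CategoryTheory.Quotient.functor _).map_surjective f.unop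
    obtain rfl : f = Quiver.Hom.op ((CategoryTheory.Quotient.functor _).map α) :=
      Quiver.Hom.unop_inj hα.symm
    refine (congrArg (· ≫ _) (dIII_comp_kInv_map α)).trans ?_
    refine Eq.trans ?_ (congrArg (_ ≫ ·) (kInv_leftOp_comp_d_rightOp_map α)).symm
    exact congrArg Quiver.Hom.op (chainFunDualIso_inv_naturality α))

/-- The functors `k` and `kInv`, regarded as functors to and from the opposite of Adelman's
category, compose to the identity. -/
def kRightOpCompKInvLeftOpIso :
    (k A).rightOp ⋙ (kInv A).leftOp ≅ 𝟭 (FPFun A) :=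
  NatIso.ofComponents (fun F => ((kInv A).asEquivalence.counitIso.app (op F)).symm.unop)
    fun f => Quiver.Hom.op_inj ((kInv A).asEquivalence.counitIso.inv.naturality f.op).symm

/-- The functors `kInv` and `k` compose to the identity of Adelman's category. -/
def kInvCompKIso : kInv A ⋙ k A ≅ 𝟭 (Adelman (FreeCat A)) :=
  (kInv A).asEquivalence.unitIso.symm

end Duality

end AGJ

end

theorem proposition2p9 (A : Type u) [Ring A] :
    Nonempty ((AGJ.k A).rightOp ⋙ AGJ.dIII A ≅ (AGJ.d A).rightOp ⋙ AGJ.k Aᵐᵒᵖ) :=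
  -- In diagrammatic order and up to opposites and associativity: `k ⋙ dIII ≅ k ⋙ dIII ⋙ kInv ⋙ k ≅
  -- k ⋙ kInv ⋙ d ⋙ k ≅ d ⋙ k`.
  ⟨(Functor.rightUnitor _).symm ≪≫
    Functor.isoWhiskerLeft _ (AGJ.kInvCompKIso Aᵐᵒᵖ).symm ≪≫
    Functor.associator _ _ _ ≪≫
    Functor.isoWhiskerLeft _ (Functor.associator _ _ _).symm ≪≫
    Functor.isoWhiskerLeft _ (Functor.isoWhiskerRight (AGJ.dIIICompKInvIso A) _) ≪≫
    Functor.isoWhiskerLeft _ (Functor.associator _ _ _) ≪≫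
    (Functor.associator _ _ _).symm ≪≫
    Functor.isoWhiskerRight (AGJ.kRightOpCompKInvLeftOpIso A) _ ≪≫
    Functor.leftUnitor _⟩
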